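/- **Setting.** Let $(F_x)_{x\in\mathbb R}$ be a Markov kernel of probability laws on $\mathbb R$ and put $M_x(y)=\int_{-\infty}^y F_x(t)\,dt=\int (y-t)_+\,dF_x(t)$, where $F_x(t)$ also denotes the distribution function. On a probability space let $(X_{ni},Y_{ni})$, $1\le i\le n$, $n\in\mathbb N$, be a triangular array of real random variables and let $S\subseteq\mathbb R$ be such that: for each $n$ the covariates $X_{n1},\dots,X_{nn}$ are independent and almost surely in $S$; conditionally on $(X_{n1},\dots,X_{nn})$ the responses $Y_{n1},\dots,Y_{nn}$ are independent and $Y_{ni}$ has law $F_{X_{ni}}$; and for $x\le x'$ in $S$, $F_x$ is smaller than $F_{x'}$ in the increasing concave order, i.e. $\int\phi\,dF_x\le\int\phi\,dF_{x'}$ for all increasing concave $\phi$ for which both expectations exist. **Estimator.** For every $y\in\mathbb R$, $(\tilde M_{n;X_{n1}}(y),\dots,\tilde M_{n;X_{nn}}(y))$ is the minimizer of $\sum_{i=1}^n[\eta_i-(y-Y_{ni})_+]^2$ over all $\eta\in\mathbb R^n$ with $\eta_i\ge\eta_j$ whenever $X_{ni}\le X_{nj}$. If $x_1<\dots<x_d$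 are the distinct values of $X_{n1},\dots,X_{nn}$, then for other $x$ the function $\tilde M_{n;x}$ is arbitrary subject to $\tilde M_{n;x_i}(y)\ge\tilde M_{n;x}(y)\ge\tilde M_{n;x_{i+1}}(y)$ for all $y$ if $x\in[x_i,x_{i+1})$, $\tilde M_{n;x}=\tilde M_{n;x_1}$ if $x<x_1$, and $\tilde M_{n;x}=\tilde M_{n;x_d}$ if $x\ge x_d$. **Conditions.** - (K) $S=\{1,\dots,K\}$, and $\mathbb P(X_{ni}=j)\ge p>0$ for all $n$, $i$ and $j\in\{1,\dots,K\}$. - (C1) $I\subseteq S$ is an interval, and every $X_{ni}$ has a Lebesgue density that is at least $p>0$ on $I$. - (C2) There is $L>0$ with $|M_u(y)-M_v(y)|\le L|u-v|$ for all $u,v\in I$, $y\in\mathbb R$. - (P) There are $\lambda>2$, $y_0\ge 0$ such that a random variable $Y\sim F_x$ satisfies $\mathbb P(|Y|\ge y)\le y^{-\lambda}$, for all $y\ge y_0$ and $x\in S$. - (E) There are $\lambda>0$, $y_0\ge 0$ such that a random variable $Y\sim F_x$ satisfies $\mathbb P(|Y|\ge y)\le\exp(-\lambda y)$, for all $y\ge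 y_0$ and $x\in S$. **Theorem.** One has $c_n\ge 0$ and $$\lim_{n\to\infty}\mathbb P\Big(\sup_{y\in\mathbb R,\,x\in I_n}|\tilde M_{n;x}(y)-M_x(y)|\ge c_n\Big)=0$$ (in terms of outer probability if the event is not measurable; the supremum over the empty set is $0$) in each of the following cases: 1. under (K) and (P), with $c_n=4p^{-1/2}n^{-1/2+1/\lambda}\log(n)^{1/2+1/\lambda}$ and $I_n=\{1,\dots,K\}$; 2. under (K) and (E), with $c_n=8p^{-1/2}\lambda^{-1}n^{-1/2}\log(n)^{3/2}$ and $I_n=\{1,\dots,K\}$; 3. under (C1), (C2) and (P), with $c_n=[4p^{-1/2}+L]\,\delta_n$ and $I_n=\{x\in I:\ x\pm\delta_n\in I\}$, where $\delta_n=n^{-1/3+2/(3\lambda)}\log(n)^{1/3+2/(3\lambda)}$; 4. under (C1), (C2) and (E), with $c_n=[4p^{-1/2}+L]\,\delta_n$ and $I_n=\{x\in I:\ x\pm\delta_n\in I\}$, where $\delta_n=(2/\lambda)^{2/3}n^{-1/3}\log(n)$. -/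

import Mathlib

open MeasureTheory ProbabilityTheory Filter Topology
open scoped ENNReal

noncomputable section

/-- The increasing concave order on laws on the real line: `P ≼ Q` if `E φ(Y₁) ≤ E φ(Y₂)`, with
`Y₁ ∼ P` and `Y₂ ∼ Q`, for every increasing concave `φ` for which both expectations exist. -/
def IcvLE (P Q : Measure ℝ) : Prop :=
  ∀ φ : ℝ → ℝ, Monotone φ → ConcaveOn ℝ Set.univ φ → Integrable φ P → Integrable φ Q →
    ∫ t, φ t ∂P ≤ ∫ t, φ t ∂Q

/-- `M_x(y) = E[(y - Y)₊ | X = x]` (the integral of the distribution function of `F x` over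
`(-∞, y]`), where `F x` is the conditional law of `Y` given `X = x`. -/
def integratedCdf (F : Kernel ℝ ℝ) (x y : ℝ) : ℝ :=
  ∫ t, max (y - t) 0 ∂(F x)

/-- The sampling model. `(X n i, Y n i)`, `i : Fin n`, is a triangular array; the covariates of each
row are independent and take values in the covariate domain `S`; given all covariates of the row,
the responses are independent, the `i`-th one having the law `F (X n i)`; and the laws `F x` are
increasing in the increasing concave order for `x ∈ S`. -/
structure IsSamplingModel {Ω : Type*} [MeasurableSpace Ω] (μ : Measure Ω) [IsProbabilityMeasure μ]
    (X Y : (n : ℕ) → Fin n → Ω → ℝ) (F : Kernel ℝ ℝ) (S : Set ℝ) : Prop where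
  measurable_covariate : ∀ n i, Measurable (X n i)
  measurable_response : ∀ n i, Measurable (Y n i)
  indep_covariate : ∀ n, iIndepFun (X n) μ
  covariate_mem : ∀ n i, ∀ᵐ ω ∂μ, X n i ω ∈ S
  condLaw_response : ∀ n,
    ∀ᵐ x ∂(μ.map fun ω i => X n i ω),
      condDistrib (fun ω i => Y n i ω) (fun ω i => X n i ω) μ x = Measure.pi fun i => F (x i)
  icv_increasing : ∀ x ∈ S, ∀ x' ∈ S, x ≤ x' → IcvLE (F x) (F x')

/-- `η` is the antitonic least squares regression of `z 0, …, z (n - 1)` with covariates `x i`: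
it minimizes the sum of squares over all `θ` with `θ i ≥ θ j` whenever `x i ≤ x j`. -/
def IsAntitonicRegression {n : ℕ} (x z η : Fin n → ℝ) : Prop :=
  (∀ i j, x i ≤ x j → η j ≤ η i) ∧
    ∀ θ : Fin n → ℝ, (∀ i j, x i ≤ x j → θ j ≤ θ i) →
      ∑ i, (η i - z i) ^ 2 ≤ ∑ i, (θ i - z i) ^ 2

/-- `m x y` is a version of the estimator computed from the covariates `X i` and the responses
`Y i`. At the observed covariates it is the antitonic regression of `(y - Y i)₊`; between two
consecutive distinct observed covariates it is any interpolation lying between the two values; to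
the left of the smallest and to the right of the largest observed covariate it is constant in
`x`. -/
structure IsEstimator {n : ℕ} (X Y : Fin n → ℝ) (m : ℝ → ℝ → ℝ) : Prop where
  regression : ∀ y, IsAntitonicRegression X (fun i => max (y - Y i) 0) (fun i => m (X i) y)
  between : ∀ i j, X i < X j → (∀ k, X k ≤ X i ∨ X j ≤ X k) →
    ∀ x, X i ≤ x → x < X j → ∀ y, m (X j) y ≤ m x y ∧ m x y ≤ m (X i) y
  left : ∀ i, (∀ k, X i ≤ X k) → ∀ x, x < X i → ∀ y, m x y = m (X i) y
  right : ∀ i, (∀ k, X k ≤ X i) → ∀ x, X i ≤ x → ∀ y, m x y = m (X i) y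

/-- Condition (A) with the rate `c n` and the sets `I n`: with probability tending to one, the
supremum over `y ∈ ℝ` and `x ∈ I n` of `|m n ω x y - M_x(y)|` is smaller than `c n`. The supremum
is taken in `[0, ∞]`, so that it is `∞` if the differences are unbounded. -/
def ConditionA {Ω : Type*} [MeasurableSpace Ω] (μ : Measure Ω) (F : Kernel ℝ ℝ)
    (m : ℕ → Ω → ℝ → ℝ → ℝ) (c : ℕ → ℝ) (I : ℕ → Set ℝ) : Prop :=
  (∀ n, 0 ≤ c n) ∧
    Tendsto
      (fun n => μ {ω | ENNReal.ofReal (c n) ≤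
        ⨆ (y : ℝ) (x ∈ I n), ENNReal.ofReal |m n ω x y - integratedCdf F x y|})
      atTop (𝓝 0)

/-- The covariate domain `{1, …, K}` of the `K`-sample case, as a set of reals. -/
def levels (K : ℕ) : Set ℝ := {x | ∃ j : ℕ, 1 ≤ j ∧ j ≤ K ∧ x = j}

/-- Condition (K): each of the levels `1, …, K` has probability at least `p > 0` under each
covariate. -/
def ConditionK {Ω : Type*} [MeasurableSpace Ω] (μ : Measure Ω) (X : (n : ℕ) → Fin n → Ω → ℝ)
    (K : ℕ) (p : ℝ) : Prop :=
  0 < p ∧ ∀ n i, ∀ x ∈ levels K, p ≤ μ.real {ω | X n i ω = x}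

/-- Condition (C1): each covariate has a Lebesgue density which is at least `p > 0` on the interval
`I`. -/
def ConditionC1 {Ω : Type*} [MeasurableSpace Ω] (μ : Measure Ω) (X : (n : ℕ) → Fin n → Ω → ℝ)
    (I : Set ℝ) (p : ℝ) : Prop :=
  0 < p ∧ I.OrdConnected ∧ ∀ n i, ∃ f : ℝ → ℝ≥0∞, Measurable f ∧
    μ.map (X n i) = volume.withDensity f ∧ ∀ x ∈ I, ENNReal.ofReal p ≤ f x

/-- Condition (C2): `M_x(y)` is Lipschitz in `x ∈ I` with constant `L > 0`, for every `y`. -/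
def ConditionC2 (F : Kernel ℝ ℝ) (I : Set ℝ) (L : ℝ) : Prop :=
  0 < L ∧ ∀ u ∈ I, ∀ v ∈ I, ∀ y, |integratedCdf F u y - integratedCdf F v y| ≤ L * |u - v|

/-- Condition (P), power tails with exponent `lam > 2` on `S`. The power is taken in `[0, ∞]`, where
`0 ^ (-lam) = ∞`. -/
def ConditionP (F : Kernel ℝ ℝ) (S : Set ℝ) (lam : ℝ) : Prop :=
  2 < lam ∧ ∃ y₀ : ℝ, 0 ≤ y₀ ∧ ∀ y, y₀ ≤ y → ∀ x ∈ S,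
    F x {t | y ≤ |t|} ≤ ENNReal.ofReal y ^ (-lam)

/-- Condition (E), exponential tails with rate `lam > 0` on `S`. -/
def ConditionE (F : Kernel ℝ ℝ) (S : Set ℝ) (lam : ℝ) : Prop :=
  0 < lam ∧ ∃ y₀ : ℝ, 0 ≤ y₀ ∧ ∀ y, y₀ ≤ y → ∀ x ∈ S,
    F x {t | y ≤ |t|} ≤ ENNReal.ofReal (Real.exp (-lam * y))

/-- The points of `I` at distance at least `δ` from the boundary: `{x ∈ I : x ± δ ∈ I}`. -/
def interiorPart (I : Set ℝ) (δ : ℝ) : Set ℝ := {x | x ∈ I ∧ x - δ ∈ I ∧ x + δ ∈ I}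

end

/-! Antitonic least squares obeys min-max inequalities: for every `u`, the fit at an observed
covariate is at most the mean of the data over some window that starts at `u` and reaches at least
to that covariate; a mirrored lower bound holds. Since `M_x(y)` decreases in `x` (the increasing
concave order tested on `t ↦ -(y - t)₊`), the mean of `M` over a window starting at `u` is at most
`M_u(y)`. So the estimator at `x` lies between `M_v(y) - d` and `M_u(y) + d` for `u ≤ x ≤ v`,
provided that `[u, x]` and `[x, v]` contain at least `N` observations and that every window with at
least `N` observations has mean noise at most `d`. The rest is to make both provisos hold with
probability tending to one.

Noise: every nonempty window is a window between two observed covariates, so at most `n²` pairs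
matter. Given the covariates the responses are independent, and with high probability all of them
lie in `[-B, B]`. For clamped responses the noise depends on `y` only through its clamping and is
Lipschitz there, so `n + 1` thresholds suffice. Hoeffding's inequality and a union bound over `n²(n
+ 1)` events give noise of order `B √(log n / (n p))` on windows with about `n p` observations; here
`TailBound` controls both the responses beyond `B` and the bias of clamping. This is
`exists_deviation_event`.

Observations: Hoeffding's inequality again. For finitely many levels take `u = v = x`, without bias.
For covariates with a density take `u, v = x ∓ δ`: the bias is at most `L δ`, the windows hold about
`n p δ` observations, and `δ³ = B² log n / n` makes the noise a multiple of `δ` too. The rates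
follow from `B = (n log n)^(1/λ)` under power tails and `B = (2/λ) log n` under exponential tails.
-/

/-! ### Windows of covariates -/

/-- The indices whose covariate lies in `[u, v]`. -/
noncomputable def window {n : ℕ} (x : Fin n → ℝ) (u v : ℝ) : Finset (Fin n) :=
  Finset.univ.filter fun i => u ≤ x i ∧ x i ≤ v

@[simp]
lemma mem_window {n : ℕ} {x : Fin n → ℝ} {u v : ℝ} {i : Fin n} :
    i ∈ window x u v ↔ u ≤ x i ∧ x i ≤ v := by
  simp [window]

lemma window_neg {n : ℕ} (x : Fin n → ℝ) (u v : ℝ) :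
    window (fun i => -x i) (-u) (-v) = window x v u := by
  ext i
  simp [and_comm]

/-- A nonempty window is a window between two observed covariates. -/
lemma exists_window_eq_left {n : ℕ} (x : Fin n → ℝ) (u v : ℝ) (h : (window x u v).Nonempty) :
    ∃ k, u ≤ x k ∧ window x u v = window x (x k) v := by
  obtain ⟨k, hk, hmin⟩ := Finset.exists_min_image _ x h
  refine ⟨k, (mem_window.1 hk).1, ?_⟩
  ext i
  constructor
  · intro hi
    exact mem_window.2 ⟨hmin i hi, (mem_window.1 hi).2⟩
  · intro hi
    exact mem_window.2 ⟨(mem_window.1 hk).1.trans (mem_window.1 hi).1, (mem_window.1 hi).2⟩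

lemma exists_window_eq_right {n : ℕ} (x : Fin n → ℝ) (u v : ℝ) (h : (window x u v).Nonempty) :
    ∃ k, x k ≤ v ∧ window x u v = window x u (x k) := by
  obtain ⟨k, hk, hmax⟩ := Finset.exists_max_image _ x h
  refine ⟨k, (mem_window.1 hk).2, ?_⟩
  ext i
  constructor
  · intro hi
    exact mem_window.2 ⟨(mem_window.1 hi).1, hmax i hi⟩
  · intro hi
    exact mem_window.2 ⟨(mem_window.1 hi).1, (mem_window.1 hi).2.trans (mem_window.1 hk).2⟩

/-! ### Min-max inequalities for antitonic regression -/

/-- One half of the min-max characterization of antitonic regression: some window that starts at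
`u` and reaches at least up to `x j` has a mean at least as large as the fitted value at `j`. -/
lemma IsAntitonicRegression.exists_card_mul_le_sum {n : ℕ} {x z η : Fin n → ℝ}
    (h : IsAntitonicRegression x z η) (u : ℝ) (j : Fin n) :
    ∃ l, x j ≤ x l ∧
      ((window x u (x l)).card : ℝ) * η j ≤ ∑ i ∈ window x u (x l), z i := by
  classical
  obtain ⟨hanti, hopt⟩ := h
  -- The window ends where the superlevel set of `η j` ends, so `η` drops strictly to its right and
  -- the fit can be lowered on the whole window without violating the constraints.
  obtain ⟨l, hl, hmax⟩ := Finset.exists_max_image (Finset.univ.filter fun i => η j ≤ η i) x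
    ⟨j, by simp⟩
  simp only [Finset.mem_filter, Finset.mem_univ, true_and] at hl hmax
  refine ⟨l, hmax j le_rfl, ?_⟩
  set A := window x u (x l) with hA
  by_contra! hlt
  have hge : ∀ i ∈ A, η j ≤ η i := fun i hi => hl.trans (hanti i l (mem_window.1 hi).2)
  -- The size of that drop; any positive number serves if no fitted value lies below `η j`.
  have hgap : ∃ e > 0, ∀ i, η i < η j → e ≤ η j - η i := by
    by_cases hne : (Finset.univ.filter fun i => η i < η j).Nonempty
    · obtain ⟨k, hk, hkm⟩ := Finset.exists_min_image _ (fun i => η j - η i) hne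
      simp only [Finset.mem_filter, Finset.mem_univ, true_and] at hk hkm
      exact ⟨η j - η k, sub_pos.2 hk, hkm⟩
    · refine ⟨1, one_pos, fun i hi => ?_⟩
      exact absurd ⟨i, by simpa using hi⟩ hne
  obtain ⟨e, he, hgap⟩ := hgap
  set s := ∑ i ∈ A, (η i - z i) with hs
  have hspos : 0 < s := by
    have : (A.card : ℝ) * η j ≤ ∑ i ∈ A, η i := by
      simpa using Finset.card_nsmul_le_sum A η (η j) hge
    rw [hs, Finset.sum_sub_distrib]
    linarith
  have hcard : (0 : ℝ) < A.card := by
    rcases A.eq_empty_or_nonempty with h0 | h0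
    · rw [h0] at hs
      simp at hs
      exact absurd hs hspos.ne'
    · exact_mod_cast h0.card_pos
  -- `r ≤ e` keeps the lowered fit antitonic. Lowering by `r` changes the sum of squares by `-2rs +
  -- r²|A|`, which is at most `-rs < 0` as `r ≤ s / |A|`: a contradiction to optimality.
  set r := min e (s / A.card) with hr
  have hrpos : 0 < r := lt_min he (div_pos hspos hcard)
  have hfeas := hopt (fun i => η i - if i ∈ A then r else 0) (by
    intro i k hik
    have hki := hanti i k hik
    by_cases hi : i ∈ A
    · by_cases hk : k ∈ A
      · simp [hi, hk, hki]
      · have hkl : x l < x k := by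
          by_contra! hc
          exact hk (mem_window.2 ⟨(mem_window.1 hi).1.trans hik, hc⟩)
        have hηk : η k < η j := by
          by_contra! hc
          exact absurd (hmax k hc) (not_le.2 hkl)
        have h1 := hgap k hηk
        have h2 := hge i hi
        have h3 : r ≤ e := min_le_left _ _
        simp only [hi, hk, if_true, if_false]
        linarith
    · by_cases hk : k ∈ A
      · simp only [hi, hk, if_true, if_false]
        linarith
      · simp [hi, hk, hki])
  have hexp : ∑ i, ((η i - if i ∈ A then r else 0) - z i) ^ 2
      = ∑ i, (η i - z i) ^ 2 + (-(2 * r * s) + r ^ 2 * A.card) := by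
    have h1 : ∀ i, ((η i - if i ∈ A then r else 0) - z i) ^ 2
        = (η i - z i) ^ 2 + if i ∈ A then (-(2 * r) * (η i - z i) + r ^ 2) else 0 := by
      intro i
      split_ifs <;> ring
    simp_rw [h1, Finset.sum_add_distrib, Finset.sum_ite_mem, Finset.univ_inter,
      Finset.sum_add_distrib, ← Finset.mul_sum, ← hs]
    simp
    ring
  have hfin := hfeas.trans_eq hexp
  have h4 : r * A.card ≤ s := by
    have := min_le_right e (s / A.card)
    rwa [le_div_iff₀ hcard] at this
  nlinarith [mul_pos hrpos hspos]

/-- Reflecting both axes preserves the constraints and the sum of squares, so the second min-max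
inequality follows from the first. -/
lemma IsAntitonicRegression.neg {n : ℕ} {x z η : Fin n → ℝ} (h : IsAntitonicRegression x z η) :
    IsAntitonicRegression (fun i => -x i) (fun i => -z i) (fun i => -η i) := by
  refine ⟨fun i j hij => neg_le_neg (h.1 j i (neg_le_neg_iff.1 hij)), fun θ hθ => ?_⟩
  have := h.2 (fun i => -θ i) (fun i j hij => neg_le_neg (hθ j i (neg_le_neg hij)))
  refine (le_of_eq ?_).trans (this.trans (le_of_eq ?_)) <;>
    exact Finset.sum_congr rfl fun i _ => by ring

/-- The other half of the min-max characterization of antitonic regression. -/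
lemma IsAntitonicRegression.exists_sum_le_card_mul {n : ℕ} {x z η : Fin n → ℝ}
    (h : IsAntitonicRegression x z η) (v : ℝ) (j : Fin n) :
    ∃ l, x l ≤ x j ∧
      ∑ i ∈ window x (x l) v, z i ≤ ((window x (x l) v).card : ℝ) * η j := by
  obtain ⟨l, hl, hle⟩ := h.neg.exists_card_mul_le_sum (-v) j
  refine ⟨l, neg_le_neg_iff.1 hl, ?_⟩
  rw [window_neg] at hle
  simp only [Finset.sum_neg_distrib] at hle
  linarith

/-! ### Deterministic error bounds for the estimator -/

/-- To the right of an observed covariate, the estimator is dominated by its value at the largest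
observed covariate that is not larger. -/
lemma IsEstimator.le_of_isGreatest {n : ℕ} {X Y : Fin n → ℝ} {m : ℝ → ℝ → ℝ}
    (h : IsEstimator X Y m) {x : ℝ} {j : Fin n} (hj : X j ≤ x) (hmax : ∀ i, X i ≤ x → X i ≤ X j)
    (y : ℝ) : m x y ≤ m (X j) y := by
  by_cases hne : (Finset.univ.filter fun i => x < X i).Nonempty
  · obtain ⟨l, hl, hmin⟩ := Finset.exists_min_image _ X hne
    simp only [Finset.mem_filter, Finset.mem_univ, true_and] at hl hmin
    refine (h.between j l (hj.trans_lt hl) (fun k => ?_) x hj hl y).2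
    rcases le_or_gt (X k) x with hk | hk
    · exact Or.inl (hmax k hk)
    · exact Or.inr (hmin k hk)
  · refine (h.right j (fun k => hmax k ?_) x hj y).le
    by_contra! hk
    exact hne ⟨k, by simpa using hk⟩

lemma IsEstimator.ge_of_isLeast {n : ℕ} {X Y : Fin n → ℝ} {m : ℝ → ℝ → ℝ}
    (h : IsEstimator X Y m) {x : ℝ} {j : Fin n} (hj : x ≤ X j) (hmin : ∀ i, x ≤ X i → X j ≤ X i)
    (y : ℝ) : m (X j) y ≤ m x y := by
  rcases hj.eq_or_lt with rfl | hlt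
  · exact le_rfl
  by_cases hne : (Finset.univ.filter fun i => X i < x).Nonempty
  · obtain ⟨l, hl, hmax⟩ := Finset.exists_max_image _ X hne
    simp only [Finset.mem_filter, Finset.mem_univ, true_and] at hl hmax
    refine (h.between l j (hl.trans hlt) (fun k => ?_) x hl.le hlt y).1
    rcases lt_or_ge (X k) x with hk | hk
    · exact Or.inl (hmax k hk)
    · exact Or.inr (hmin k hk)
  · refine (h.left j (fun k => hmin k ?_) x hlt y).ge
    by_contra! hk
    exact hne ⟨k, by simpa using hk⟩

/-- Deterministic upper bound for the estimator: if on all windows with at least `N` observations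
the mean of the transformed responses is within `d` of the mean of `M` and if there are at least `N`
observations in `[u, x]`, then the estimator at `x` is at most `M u + d`. -/
lemma IsEstimator.le_add_of_window {n : ℕ} {X Y : Fin n → ℝ} {m : ℝ → ℝ → ℝ}
    (h : IsEstimator X Y m) {S : Set ℝ} {M : ℝ → ℝ} {y d N u x : ℝ}
    (hX : ∀ i, X i ∈ S) (hM : ∀ a ∈ S, ∀ b ∈ S, a ≤ b → M b ≤ M a) (hN : 0 < N)
    (hdev : ∀ k l, N ≤ (window X (X k) (X l)).card →
      |∑ i ∈ window X (X k) (X l), (max (y - Y i) 0 - M (X i))|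
        ≤ (window X (X k) (X l)).card * d)
    (hu : u ∈ S) (hcard : N ≤ (window X u x).card) : m x y ≤ M u + d := by
  have hpos : (window X u x).Nonempty := by
    rw [← Finset.card_pos]
    exact_mod_cast hN.trans_le hcard
  obtain ⟨j, hj, hmax⟩ := Finset.exists_max_image _ X hpos
  have hju := (mem_window.1 hj).1
  refine (h.le_of_isGreatest (mem_window.1 hj).2 (fun i hi => ?_) y).trans ?_
  · rcases le_or_gt u (X i) with hui | hui
    · exact hmax i (mem_window.2 ⟨hui, hi⟩)
    · exact hui.le.trans hju
  obtain ⟨l, hl, hle⟩ := (h.regression y).exists_card_mul_le_sum u j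
  have hsub : window X u x ⊆ window X u (X l) := fun i hi =>
    mem_window.2 ⟨(mem_window.1 hi).1, (hmax i hi).trans hl⟩
  have hNA : N ≤ (window X u (X l)).card :=
    hcard.trans (by exact_mod_cast Finset.card_le_card hsub)
  -- The endpoint `u` need not be observed; moving it to the first covariate in the window brings
  -- the window under `hdev`.
  obtain ⟨k, -, hk⟩ := exists_window_eq_left X u (X l) (hpos.mono hsub)
  have hd := hdev k l (by rwa [← hk])
  rw [← hk] at hd
  set A := window X u (X l)
  have hApos : (0 : ℝ) < A.card := hN.trans_le hNA
  have hMs : ∑ i ∈ A, M (X i) ≤ A.card * M u := by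
    have := Finset.sum_le_card_nsmul A (fun i => M (X i)) (M u)
      fun i hi => hM u hu _ (hX i) (mem_window.1 hi).1
    simpa using this
  have h1 := (abs_le.1 hd).2
  rw [Finset.sum_sub_distrib] at h1
  have h2 : (A.card : ℝ) * m (X j) y ≤ A.card * (M u + d) := by
    rw [mul_add]
    linarith
  exact le_of_mul_le_mul_left h2 hApos

/-- Mirror image of the upper bound: start from the smallest covariate at or above `x`, extend the
window to the left with `v` fixed, and use that `M ≥ M v` on it. -/
lemma IsEstimator.sub_le_of_window {n : ℕ} {X Y : Fin n → ℝ} {m : ℝ → ℝ → ℝ}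
    (h : IsEstimator X Y m) {S : Set ℝ} {M : ℝ → ℝ} {y d N v x : ℝ}
    (hX : ∀ i, X i ∈ S) (hM : ∀ a ∈ S, ∀ b ∈ S, a ≤ b → M b ≤ M a) (hN : 0 < N)
    (hdev : ∀ k l, N ≤ (window X (X k) (X l)).card →
      |∑ i ∈ window X (X k) (X l), (max (y - Y i) 0 - M (X i))|
        ≤ (window X (X k) (X l)).card * d)
    (hv : v ∈ S) (hcard : N ≤ (window X x v).card) : M v - d ≤ m x y := by
  have hpos : (window X x v).Nonempty := by
    rw [← Finset.card_pos]
    exact_mod_cast hN.trans_le hcard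
  obtain ⟨j, hj, hmin⟩ := Finset.exists_min_image _ X hpos
  have hjv := (mem_window.1 hj).2
  refine le_trans ?_ (h.ge_of_isLeast (mem_window.1 hj).1 (fun i hi => ?_) y)
  swap
  · rcases le_or_gt (X i) v with hui | hui
    · exact hmin i (mem_window.2 ⟨hi, hui⟩)
    · exact hjv.trans hui.le
  obtain ⟨l, hl, hle⟩ := (h.regression y).exists_sum_le_card_mul v j
  have hsub : window X x v ⊆ window X (X l) v := fun i hi =>
    mem_window.2 ⟨hl.trans (hmin i hi), (mem_window.1 hi).2⟩
  have hNA : N ≤ (window X (X l) v).card :=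
    hcard.trans (by exact_mod_cast Finset.card_le_card hsub)
  obtain ⟨k, -, hk⟩ := exists_window_eq_right X (X l) v (hpos.mono hsub)
  have hd := hdev l k (by rwa [← hk])
  rw [← hk] at hd
  set A := window X (X l) v
  have hApos : (0 : ℝ) < A.card := hN.trans_le hNA
  have hMs : A.card * M v ≤ ∑ i ∈ A, M (X i) := by
    have := Finset.card_nsmul_le_sum A (fun i => M (X i)) (M v)
      fun i hi => hM _ (hX i) v hv (mem_window.1 hi).2
    simpa using this
  have h1 := (abs_le.1 hd).1
  rw [Finset.sum_sub_distrib] at h1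
  have h2 : (A.card : ℝ) * (M v - d) ≤ A.card * m (X j) y := by
    rw [mul_sub]
    linarith
  exact le_of_mul_le_mul_left h2 hApos

/-! ### Hoeffding's inequality and conditioning on the covariates -/

/-- Hoeffding's inequality for the mean of bounded independent random variables. -/
lemma measureReal_mul_card_le_sum_sub_integral_le {Ω ι : Type*} [MeasurableSpace Ω]
    {μ : Measure Ω} [IsProbabilityMeasure μ] {Z : ι → Ω → ℝ} (hZ : iIndepFun Z μ)
    (hm : ∀ i, AEMeasurable (Z i) μ) {a b : ℝ} (hb : ∀ i ω, Z i ω ∈ Set.Icc a b)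
    (A : Finset ι) {s : ℝ} (hs : 0 ≤ s) :
    μ.real {ω | s * A.card ≤ ∑ i ∈ A, (Z i ω - ∫ ω', Z i ω' ∂μ)}
      ≤ Real.exp (-(2 * A.card * s ^ 2 / (b - a) ^ 2)) := by
  have hind : iIndepFun (fun i ω => Z i ω - ∫ ω', Z i ω' ∂μ) μ :=
    hZ.comp (fun i z => z - ∫ ω', Z i ω' ∂μ) fun i => measurable_id.sub_const _
  have h := HasSubgaussianMGF.measure_sum_ge_le_of_iIndepFun hind (s := A)
    (c := fun _ => (‖b - a‖₊ / 2) ^ 2)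
    (fun i _ => hasSubgaussianMGF_of_mem_Icc (hm i) (ae_of_all _ (hb i)))
    (ε := s * A.card) (by positivity)
  refine h.trans (le_of_eq ?_)
  congr 1
  simp only [Finset.sum_const, nsmul_eq_mul]
  push_cast
  rw [Real.norm_eq_abs, div_pow, sq_abs]
  -- In the degenerate cases, `A` empty or `a = b`, both exponents are zero because division by zero
  -- gives zero.
  rcases A.eq_empty_or_nonempty with rfl | hA
  · simp
  have hc : (A.card : ℝ) ≠ 0 := by exact_mod_cast hA.card_pos.ne'
  rcases eq_or_ne (b - a) 0 with h0 | h0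
  · simp [h0]
  field_simp

/-- Two-sided version of Hoeffding's inequality. -/
lemma measureReal_mul_card_le_abs_sum_sub_integral_le {Ω ι : Type*} [MeasurableSpace Ω]
    {μ : Measure Ω} [IsProbabilityMeasure μ] {Z : ι → Ω → ℝ} (hZ : iIndepFun Z μ)
    (hm : ∀ i, AEMeasurable (Z i) μ) {a b : ℝ} (hb : ∀ i ω, Z i ω ∈ Set.Icc a b)
    (A : Finset ι) {s : ℝ} (hs : 0 ≤ s) :
    μ.real {ω | s * A.card ≤ |∑ i ∈ A, (Z i ω - ∫ ω', Z i ω' ∂μ)|}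
      ≤ 2 * Real.exp (-(2 * A.card * s ^ 2 / (b - a) ^ 2)) := by
  have h1 := measureReal_mul_card_le_sum_sub_integral_le hZ hm hb A hs
  have h2 := measureReal_mul_card_le_sum_sub_integral_le (Z := fun i ω => -Z i ω)
    (hZ.comp (fun _ z => -z) fun _ => measurable_neg) (fun i => (hm i).neg)
    (a := -b) (b := -a) (fun i ω => ⟨neg_le_neg (hb i ω).2, neg_le_neg (hb i ω).1⟩) A hs
  have hsub : {ω | s * A.card ≤ |∑ i ∈ A, (Z i ω - ∫ ω', Z i ω' ∂μ)|}
      ⊆ {ω | s * A.card ≤ ∑ i ∈ A, (Z i ω - ∫ ω', Z i ω' ∂μ)}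
        ∪ {ω | s * A.card ≤ ∑ i ∈ A, (-Z i ω - ∫ ω', -Z i ω' ∂μ)} := by
    intro ω hω
    rcases le_abs.1 (show s * A.card ≤ |∑ i ∈ A, (Z i ω - ∫ ω', Z i ω' ∂μ)| from hω) with h | h
    · exact Or.inl h
    · refine Or.inr (h.trans_eq ?_)
      rw [← Finset.sum_neg_distrib]
      refine Finset.sum_congr rfl fun i _ => ?_
      rw [integral_neg]
      ring
  have hba : (-a - -b) ^ 2 = (b - a) ^ 2 := by ring
  rw [hba] at h2
  calc _ ≤ _ := measureReal_mono hsub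
    _ ≤ _ := measureReal_union_le _ _
    _ ≤ _ := by linarith

/-- The events of a row can be bounded conditionally on the covariates. -/
lemma measure_le_of_condLaw {Ω : Type*} [MeasurableSpace Ω] {μ : Measure Ω}
    [IsProbabilityMeasure μ] {F : Kernel ℝ ℝ} {n : ℕ} {X Y : Fin n → Ω → ℝ}
    (hY : ∀ i, Measurable (Y i)) (hX : ∀ i, Measurable (X i))
    (hc : ∀ᵐ x ∂(μ.map fun ω i => X i ω),
      condDistrib (fun ω i => Y i ω) (fun ω i => X i ω) μ x = Measure.pi fun i => F (x i))
    {s : Set ((Fin n → ℝ) × (Fin n → ℝ))} (hs : MeasurableSet s) {q : ℝ≥0∞}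
    (hq : ∀ᵐ x ∂(μ.map fun ω i => X i ω), (Measure.pi fun i => F (x i)) (Prod.mk x ⁻¹' s) ≤ q) :
    μ {ω | ((fun i => X i ω), (fun i => Y i ω)) ∈ s} ≤ q := by
  have hXm : Measurable fun ω i => X i ω := measurable_pi_lambda _ hX
  have hYm : Measurable fun ω i => Y i ω := measurable_pi_lambda _ hY
  have : IsProbabilityMeasure (μ.map fun ω i => X i ω) :=
    Measure.isProbabilityMeasure_map hXm.aemeasurable
  have h1 : μ {ω | ((fun i => X i ω), (fun i => Y i ω)) ∈ s}
      = (μ.map fun ω => ((fun i => X i ω), (fun i => Y i ω))) s :=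
    (Measure.map_apply (hXm.prodMk hYm) hs).symm
  rw [h1, ← compProd_map_condDistrib (X := fun ω i => X i ω) (Y := fun ω i => Y i ω)
    hYm.aemeasurable, Measure.compProd_apply hs]
  calc _ ≤ ∫⁻ _, q ∂(μ.map fun ω i => X i ω) := by
        refine lintegral_mono_ae ?_
        filter_upwards [hc, hq] with x h2 h3
        rwa [h2]
    _ = q := by simp

/-! ### Clamped responses and uniformity in the threshold -/

/-- The clamping of `t` to `[-B, B]`. -/
noncomputable def clamp (B t : ℝ) : ℝ := max (-B) (min B t)

lemma measurable_clamp (B : ℝ) : Measurable (clamp B) := by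
  unfold clamp
  fun_prop

lemma clamp_mem {B : ℝ} (hB : 0 ≤ B) (t : ℝ) : clamp B t ∈ Set.Icc (-B) B :=
  ⟨le_max_left _ _, max_le (by linarith) (min_le_left _ _)⟩

lemma clamp_eq_self {B t : ℝ} (h : |t| ≤ B) : clamp B t = t := by
  rw [clamp, min_eq_right (abs_le.1 h).2, max_eq_right (abs_le.1 h).1]

lemma abs_sub_clamp {B : ℝ} (hB : 0 ≤ B) (t : ℝ) : |t - clamp B t| = max (|t| - B) 0 := by
  unfold clamp
  rcases le_total t 0 with h | h
  · rw [min_eq_right (h.trans hB), abs_of_nonpos h]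
    rcases le_total (-B) t with h' | h'
    · rw [max_eq_right h', sub_self, abs_zero, max_eq_right (by linarith)]
    · rw [max_eq_left h', max_eq_left (by linarith), abs_of_nonpos (by linarith)]
      ring
  · rw [max_eq_right (le_min (by linarith) (by linarith)), abs_of_nonneg h]
    rcases le_total B t with h' | h'
    · rw [min_eq_left h', max_eq_left (by linarith), abs_of_nonneg (by linarith)]
    · rw [min_eq_right h', sub_self, abs_zero, max_eq_right (by linarith)]

/-- The function `M_x(y)` of the clamped responses. -/
noncomputable def clampedCdf (F : Kernel ℝ ℝ) (B x y : ℝ) : ℝ :=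
  ∫ t, max (y - clamp B t) 0 ∂(F x)

lemma measurable_clampedCdf (F : Kernel ℝ ℝ) (B y : ℝ) :
    Measurable fun x => clampedCdf F B x y := by
  have hm : Measurable fun t => max (y - clamp B t) 0 :=
    (measurable_const.sub (measurable_clamp B)).max measurable_const
  exact hm.stronglyMeasurable.integral_kernel.measurable

/-- The range of length `2B` for Hoeffding's inequality, whose exponent becomes `|A| s² / (2 B²)`.
Only `y ≤ B` is needed, hence the one-sided `gridPoint_le`. -/
lemma max_sub_clamp_mem {B y : ℝ} (hB : 0 ≤ B) (hy : y ≤ B) (t : ℝ) :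
    max (y - clamp B t) 0 ∈ Set.Icc 0 (2 * B) :=
  ⟨le_max_right _ _, max_le (by linarith [(clamp_mem hB t).1]) (by linarith)⟩

/-- For one window and one threshold, a large deviation is unlikely. -/
lemma measure_window_deviation_le {Ω : Type*} [MeasurableSpace Ω] {μ : Measure Ω}
    [IsProbabilityMeasure μ] {F : Kernel ℝ ℝ} [IsMarkovKernel F] {n : ℕ} {X Y : Fin n → Ω → ℝ}
    (hY : ∀ i, Measurable (Y i)) (hX : ∀ i, Measurable (X i))
    (hc : ∀ᵐ x ∂(μ.map fun ω i => X i ω),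
      condDistrib (fun ω i => Y i ω) (fun ω i => X i ω) μ x = Measure.pi fun i => F (x i))
    {B N s y : ℝ} (hB : 0 ≤ B) (hs : 0 ≤ s) (hy : y ≤ B) (k l : Fin n) :
    μ {ω | N ≤ (window (fun i => X i ω) (X k ω) (X l ω)).card ∧
        s * (window (fun i => X i ω) (X k ω) (X l ω)).card
          ≤ |∑ i ∈ window (fun i => X i ω) (X k ω) (X l ω),
              (max (y - clamp B (Y i ω)) 0 - clampedCdf F B (X i ω) y)|}
      ≤ ENNReal.ofReal (2 * Real.exp (-(N * s ^ 2 / (2 * B ^ 2)))) := by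
  have hgm : Measurable fun t => max (y - clamp B t) 0 :=
    (measurable_const.sub (measurable_clamp B)).max measurable_const
  -- The window is a random index set; sums over all indices with indicators make the measurability
  -- in covariates and responses accessible.
  have hcardeq : ∀ x : Fin n → ℝ, ((window x (x k) (x l)).card : ℝ)
      = ∑ i, if x k ≤ x i ∧ x i ≤ x l then (1 : ℝ) else 0 := fun x => by
    simp [window]
  have hsumeq : ∀ (x : Fin n → ℝ) (g : Fin n → ℝ), ∑ i ∈ window x (x k) (x l), g i
      = ∑ i, if x k ≤ x i ∧ x i ≤ x l then g i else 0 := fun x g => by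
    rw [window, Finset.sum_filter]
  have hset : ∀ i, MeasurableSet
      {w : (Fin n → ℝ) × (Fin n → ℝ) | w.1 k ≤ w.1 i ∧ w.1 i ≤ w.1 l} := fun i => by
    rw [Set.ofPred_and]
    exact (measurableSet_le (by fun_prop) (by fun_prop)).inter
      (measurableSet_le (by fun_prop) (by fun_prop))
  have hcm : Measurable fun w : (Fin n → ℝ) × (Fin n → ℝ) =>
      ((window w.1 (w.1 k) (w.1 l)).card : ℝ) := by
    simp_rw [hcardeq]
    exact Finset.measurable_sum _ fun i _ =>
      Measurable.ite (hset i) measurable_const measurable_const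
  have hsm : Measurable fun w : (Fin n → ℝ) × (Fin n → ℝ) =>
      ∑ i ∈ window w.1 (w.1 k) (w.1 l),
        (max (y - clamp B (w.2 i)) 0 - clampedCdf F B (w.1 i) y) := by
    simp_rw [hsumeq]
    refine Finset.measurable_sum _ fun i _ =>
      Measurable.ite (hset i) (Measurable.sub ?_ ?_) measurable_const
    · exact hgm.comp (by fun_prop : Measurable fun w : (Fin n → ℝ) × (Fin n → ℝ) => w.2 i)
    · exact (measurable_clampedCdf F B y).comp
        (by fun_prop : Measurable fun w : (Fin n → ℝ) × (Fin n → ℝ) => w.1 i)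
  refine measure_le_of_condLaw hY hX hc
    (s := {w | N ≤ (window w.1 (w.1 k) (w.1 l)).card ∧
      s * (window w.1 (w.1 k) (w.1 l)).card ≤ |∑ i ∈ window w.1 (w.1 k) (w.1 l),
        (max (y - clamp B (w.2 i)) 0 - clampedCdf F B (w.1 i) y)|})
    ((measurableSet_le measurable_const hcm).inter
      (measurableSet_le (hcm.const_mul s) (continuous_abs.measurable.comp hsm)))
    (ae_of_all _ fun x => ?_)
  -- Once the covariates are fixed, so is the window: either it is too small and the event is empty,
  -- or Hoeffding's inequality applies to a deterministic index set.
  by_cases hN : N ≤ (window x (x k) (x l)).card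
  swap
  · have : (Prod.mk x ⁻¹' {w : (Fin n → ℝ) × (Fin n → ℝ) |
        N ≤ (window w.1 (w.1 k) (w.1 l)).card ∧
        s * (window w.1 (w.1 k) (w.1 l)).card ≤ |∑ i ∈ window w.1 (w.1 k) (w.1 l),
        (max (y - clamp B (w.2 i)) 0 - clampedCdf F B (w.1 i) y)|}) = ∅ := by
      ext w
      simp [hN]
    rw [this]
    simp
  have hind : iIndepFun (fun i (w : Fin n → ℝ) => max (y - clamp B (w i)) 0)
      (Measure.pi fun i => F (x i)) :=
    iIndepFun_pi (X := fun _ t => max (y - clamp B t) 0) fun i => hgm.aemeasurable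
  have hH := measureReal_mul_card_le_abs_sum_sub_integral_le hind
    (fun i => (hgm.comp (measurable_pi_apply i)).aemeasurable)
    (a := 0) (b := 2 * B) (fun i w => max_sub_clamp_mem hB hy (w i)) (window x (x k) (x l)) hs
  have hintg : ∀ i, ∫ w : Fin n → ℝ, max (y - clamp B (w i)) 0 ∂(Measure.pi fun i => F (x i))
      = clampedCdf F B (x i) y := fun i =>
    integral_comp_eval (μ := fun i => F (x i)) (i := i) (f := fun t => max (y - clamp B t) 0)
      hgm.aestronglyMeasurable
  simp_rw [hintg] at hH
  rw [← ENNReal.ofReal_toReal (measure_ne_top _ _)]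
  refine ENNReal.ofReal_le_ofReal (le_trans (measureReal_mono ?_) (hH.trans ?_))
  · exact fun w hw => hw.2
  · gcongr 2 * Real.exp (-?_)
    rw [show (2 * B - 0) ^ 2 = 2 * (2 * B ^ 2) by ring,
      show 2 * ((window x (x k) (x l)).card : ℝ) * s ^ 2
        = 2 * ((window x (x k) (x l)).card * s ^ 2) by ring,
      mul_div_mul_left _ _ two_ne_zero]
    gcongr

lemma integrable_max_sub_clamp (P : Measure ℝ) [IsFiniteMeasure P] {B : ℝ} (hB : 0 ≤ B) (y : ℝ) :
    Integrable (fun t => max (y - clamp B t) 0) P := by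
  refine Integrable.of_bound ((measurable_const.sub (measurable_clamp B)).max
    measurable_const).aestronglyMeasurable (|y| + B) (ae_of_all _ fun t => ?_)
  rw [Real.norm_of_nonneg (le_max_right _ _)]
  refine max_le ?_ (by positivity)
  linarith [(clamp_mem hB t).1, le_abs_self y]

lemma abs_max_sub_sub_max_sub_le (y y' c : ℝ) :
    |max (y - c) 0 - max (y' - c) 0| ≤ |y - y'| := by
  have := abs_max_sub_max_le_abs (y - c) (y' - c) 0
  simpa using this

/-- The centered transformed response is Lipschitz in the threshold. -/
lemma abs_centered_sub_centered_le (F : Kernel ℝ ℝ) [IsMarkovKernel F] {B : ℝ} (hB : 0 ≤ B)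
    (x c y y' : ℝ) :
    |(max (y - clamp B c) 0 - clampedCdf F B x y) - (max (y' - clamp B c) 0 - clampedCdf F B x y')|
      ≤ 2 * |y - y'| := by
  have h1 := abs_max_sub_sub_max_sub_le y y' (clamp B c)
  have h2 : |clampedCdf F B x y - clampedCdf F B x y'| ≤ |y - y'| := by
    rw [clampedCdf, clampedCdf, ← integral_sub (integrable_max_sub_clamp _ hB y)
      (integrable_max_sub_clamp _ hB y')]
    have := norm_integral_le_of_norm_le_const (μ := F x) (C := |y - y'|)
      (f := fun t => max (y - clamp B t) 0 - max (y' - clamp B t) 0)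
      (ae_of_all _ fun t => abs_max_sub_sub_max_sub_le y y' (clamp B t))
    simpa using this
  calc _ = |(max (y - clamp B c) 0 - max (y' - clamp B c) 0)
          - (clampedCdf F B x y - clampedCdf F B x y')| := by congr 1; ring
    _ ≤ _ := abs_sub _ _
    _ ≤ _ := by linarith

/-- The centered transformed response depends on the threshold through its clamping only. -/
lemma centered_eq_centered_clamp (F : Kernel ℝ ℝ) [IsMarkovKernel F] {B : ℝ} (hB : 0 ≤ B)
    (x c y : ℝ) :
    max (y - clamp B c) 0 - clampedCdf F B x y
      = max (clamp B y - clamp B c) 0 - clampedCdf F B x (clamp B y) := by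
  -- Below `-B` both terms vanish; above `B` both grow by the same amount `y - B`, which cancels.
  rcases le_total y (-B) with h | h
  · have hy : clamp B y = -B := by
      rw [clamp, max_eq_left ((min_le_right _ _).trans h)]
    have hz : ∀ z ≤ -B, ∀ t, max (z - clamp B t) 0 = 0 := fun z hz t =>
      max_eq_right (by linarith [(clamp_mem hB t).1])
    simp [clampedCdf, hy, hz y h, hz (-B) le_rfl]
  rcases le_total y B with h' | h'
  · rw [clamp_eq_self (abs_le.2 ⟨h, h'⟩)]
  · have hy : clamp B y = B := by
      rw [clamp, min_eq_left h', max_eq_right (by linarith)]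
    have hz : ∀ t, max (y - clamp B t) 0 = (y - B) + max (B - clamp B t) 0 := fun t => by
      have := (clamp_mem hB t).2
      rw [max_eq_left (by linarith), max_eq_left (by linarith)]
      ring
    simp only [clampedCdf, hy, hz]
    rw [integral_add (integrable_const _) (integrable_max_sub_clamp _ hB B)]
    simp

/-- The points of an equidistant grid in `[-B, B]`. -/
noncomputable def gridPoint (n : ℕ) (B : ℝ) (g : ℕ) : ℝ := -B + 2 * B * g / n

lemma gridPoint_le {n : ℕ} (hn : 0 < n) {B : ℝ} (hB : 0 ≤ B) {g : ℕ} (hg : g ≤ n) :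
    gridPoint n B g ≤ B := by
  have hn' : (0 : ℝ) < n := by exact_mod_cast hn
  have : 2 * B * g / n ≤ 2 * B := by
    rw [div_le_iff₀ hn']
    gcongr
  unfold gridPoint
  linarith

lemma exists_gridPoint_near {n : ℕ} (hn : 0 < n) {B y : ℝ} (hB : 0 < B)
    (hy : y ∈ Set.Icc (-B) B) : ∃ g ≤ n, |y - gridPoint n B g| ≤ 2 * B / n := by
  have hn' : (0 : ℝ) < n := by exact_mod_cast hn
  set r := (y + B) * n / (2 * B) with hr
  have hr0 : 0 ≤ r := by
    have : 0 ≤ y + B := by linarith [hy.1]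
    positivity
  have hrn : r ≤ n := by
    rw [hr, div_le_iff₀ (by positivity), mul_comm]
    gcongr
    linarith [hy.2]
  refine ⟨⌊r⌋₊, Nat.floor_le_of_le hrn, ?_⟩
  have h1 : y - gridPoint n B ⌊r⌋₊ = 2 * B / n * (r - ⌊r⌋₊) := by
    rw [gridPoint, hr]
    field_simp
    ring
  have h2 := Nat.floor_le hr0
  have h3 := Nat.lt_floor_add_one r
  have hpos : 0 ≤ 2 * B / n := by positivity
  rw [h1, abs_of_nonneg (mul_nonneg hpos (by linarith))]
  exact mul_le_of_le_one_right hpos (by linarith)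

/-- A deviation bound on the grid extends to all thresholds. -/
lemma abs_sum_centered_le_of_grid (F : Kernel ℝ ℝ) [IsMarkovKernel F] {n : ℕ} (hn : 0 < n)
    {B s : ℝ} (hB : 0 < B) (A : Finset (Fin n)) (x c : Fin n → ℝ)
    (h : ∀ g ≤ n, |∑ i ∈ A, (max (gridPoint n B g - clamp B (c i)) 0
      - clampedCdf F B (x i) (gridPoint n B g))| ≤ s * A.card) (y : ℝ) :
    |∑ i ∈ A, (max (y - clamp B (c i)) 0 - clampedCdf F B (x i) y)|
      ≤ A.card * (s + 4 * B / n) := by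
  simp_rw [fun i => centered_eq_centered_clamp F hB.le (x i) (c i) y]
  -- Mesh `2B / n` times Lipschitz constant `2` gives the extra `4B / n`.
  obtain ⟨g, hg, hyg⟩ := exists_gridPoint_near hn hB (clamp_mem hB.le y)
  have h1 := h g hg
  set y' := clamp B y
  set z := gridPoint n B g
  have h2 : |∑ i ∈ A, (max (y' - clamp B (c i)) 0 - clampedCdf F B (x i) y')
      - ∑ i ∈ A, (max (z - clamp B (c i)) 0 - clampedCdf F B (x i) z)|
      ≤ A.card * (4 * B / n) := by
    rw [← Finset.sum_sub_distrib]
    refine (Finset.abs_sum_le_sum_abs _ _).trans ?_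
    have := Finset.sum_le_card_nsmul A (fun i => |(max (y' - clamp B (c i)) 0
      - clampedCdf F B (x i) y') - (max (z - clamp B (c i)) 0 - clampedCdf F B (x i) z)|)
      (4 * B / n) fun i _ => (abs_centered_sub_centered_le F hB.le (x i) (c i) y' z).trans
        (by rw [show 4 * B / n = 2 * (2 * B / n) by ring]; linarith)
    simpa using this
  have h3 := abs_sub_abs_le_abs_sub (∑ i ∈ A, (max (y' - clamp B (c i)) 0
    - clampedCdf F B (x i) y')) (∑ i ∈ A, (max (z - clamp B (c i)) 0 - clampedCdf F B (x i) z))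
  rw [mul_add]
  linarith

/-! ### Tail bounds, clamping bias and monotonicity of `M` -/

/-- On `S`, exceedances of `B` have probability at most `q`, the mean exceedance is at most `β`,
and the laws are integrable. -/
def TailBound (F : Kernel ℝ ℝ) (S : Set ℝ) (B q β : ℝ) : Prop :=
  ∀ x ∈ S, F x {t | B ≤ |t|} ≤ ENNReal.ofReal q ∧ Integrable (fun t => t) (F x) ∧
    ∫ t, max (|t| - B) 0 ∂(F x) ≤ β

lemma integrable_max_sub {P : Measure ℝ} [IsFiniteMeasure P] (hP : Integrable (fun t => t) P)
    (y : ℝ) : Integrable (fun t => max (y - t) 0) P :=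
  ((integrable_const y).sub hP).sup (integrable_const 0)

/-- The map `t ↦ (y - t)₊` is 1-Lipschitz, so the bias is at most `E|Y - clamp B Y|`, the mean
exceedance. -/
lemma TailBound.abs_integratedCdf_sub_clampedCdf_le {F : Kernel ℝ ℝ} [IsMarkovKernel F]
    {S : Set ℝ} {B q β : ℝ} (h : TailBound F S B q β) (hB : 0 ≤ B) {x : ℝ} (hx : x ∈ S) (y : ℝ) :
    |integratedCdf F x y - clampedCdf F B x y| ≤ β := by
  obtain ⟨-, hintg, hle⟩ := h x hx
  rw [integratedCdf, clampedCdf, ← integral_sub (integrable_max_sub hintg y)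
    (integrable_max_sub_clamp _ hB y)]
  refine (abs_integral_le_integral_abs).trans (le_trans (integral_mono ?_ ?_ fun t => ?_) hle)
  · exact ((integrable_max_sub hintg y).sub (integrable_max_sub_clamp _ hB y)).abs
  · exact (hintg.abs.sub (integrable_const B)).sup (integrable_const 0)
  · have := abs_max_sub_max_le_abs (y - t) (y - clamp B t) 0
    rw [← abs_sub_clamp hB, abs_sub_comm t]
    simpa using this

/-- The test function `t ↦ -(y - t)₊` is increasing and concave. -/
lemma integratedCdf_le_of_icvLE {F : Kernel ℝ ℝ} [IsMarkovKernel F] {x x' : ℝ}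
    (h : IcvLE (F x) (F x')) (hx : Integrable (fun t => t) (F x))
    (hx' : Integrable (fun t => t) (F x')) (y : ℝ) :
    integratedCdf F x' y ≤ integratedCdf F x y := by
  have := h (fun t => -max (y - t) 0) (fun a b hab => by
      simp only [neg_le_neg_iff]
      exact max_le_max (by linarith) le_rfl) ?_
    (integrable_max_sub hx y).neg (integrable_max_sub hx' y).neg
  · rw [integral_neg, integral_neg] at this
    exact neg_le_neg_iff.1 this
  · refine (ConvexOn.sup ?_ (convexOn_const 0 convex_univ)).neg
    refine ⟨convex_univ, fun a _ b _ r s _ _ hrs => le_of_eq ?_⟩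
    simp only [smul_eq_mul]
    linear_combination (-y) * hrs

/-- Marginal tail bound for one response. -/
lemma measure_response_tail_le {Ω : Type*} [MeasurableSpace Ω] {μ : Measure Ω}
    [IsProbabilityMeasure μ] {F : Kernel ℝ ℝ} [IsMarkovKernel F] {n : ℕ} {X Y : Fin n → Ω → ℝ}
    (hY : ∀ i, Measurable (Y i)) (hX : ∀ i, Measurable (X i)) {S : Set ℝ}
    (hS : ∀ i, ∀ᵐ ω ∂μ, X i ω ∈ S)
    (hc : ∀ᵐ x ∂(μ.map fun ω i => X i ω),
      condDistrib (fun ω i => Y i ω) (fun ω i => X i ω) μ x = Measure.pi fun i => F (x i))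
    {B : ℝ} {q : ℝ≥0∞} (hq : ∀ x ∈ S, F x {t | B ≤ |t|} ≤ q) (i : Fin n) :
    μ {ω | B ≤ |Y i ω|} ≤ q := by
  have hm : MeasurableSet {t : ℝ | B ≤ |t|} :=
    measurableSet_le measurable_const continuous_abs.measurable
  have hXm : Measurable fun ω i => X i ω := measurable_pi_lambda _ hX
  refine measure_le_of_condLaw hY hX hc
    (s := (fun w : (Fin n → ℝ) × (Fin n → ℝ) => w.2 i) ⁻¹' {t : ℝ | B ≤ |t|})
    ((by fun_prop : Measurable fun w : (Fin n → ℝ) × (Fin n → ℝ) => w.2 i) hm) ?_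
  have hT : MeasurableSet {x : Fin n → ℝ | F (x i) {t | B ≤ |t|} ≤ q} :=
    measurableSet_le ((F.measurable_coe hm).comp (measurable_pi_apply i)) measurable_const
  refine ((ae_map_iff hXm.aemeasurable hT).2 ?_).mono fun x hx => ?_
  · filter_upwards [hS i] with ω hω using hq _ hω
  · have : (Measure.pi fun i => F (x i)) (Prod.mk x ⁻¹'
        ((fun w : (Fin n → ℝ) × (Fin n → ℝ) => w.2 i) ⁻¹' {t : ℝ | B ≤ |t|}))
        = F (x i) {t : ℝ | B ≤ |t|} :=
      (measurePreserving_eval (fun i => F (x i)) i).measure_preimage hm.nullMeasurableSet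
    rw [this]
    exact hx

/-! ### The uniform deviation event -/

/-- Outside of an event of small probability, the covariates lie in `S` and on all windows with at
least `N` observations the mean of the transformed responses is close to the mean of `M`, uniformly
in the threshold. -/
lemma exists_deviation_event {Ω : Type*} [MeasurableSpace Ω] {μ : Measure Ω}
    [IsProbabilityMeasure μ] {F : Kernel ℝ ℝ} [IsMarkovKernel F] {n : ℕ} (hn : 0 < n)
    {X Y : Fin n → Ω → ℝ} (hY : ∀ i, Measurable (Y i)) (hX : ∀ i, Measurable (X i)) {S : Set ℝ}
    (hS : ∀ i, ∀ᵐ ω ∂μ, X i ω ∈ S)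
    (hc : ∀ᵐ x ∂(μ.map fun ω i => X i ω),
      condDistrib (fun ω i => Y i ω) (fun ω i => X i ω) μ x = Measure.pi fun i => F (x i))
    {B N s q β : ℝ} (hB : 0 < B) (hs : 0 ≤ s) (hT : TailBound F S B q β) :
    ∃ E : Set Ω, μ E ≤ n * ENNReal.ofReal q
        + n * n * (n + 1) * ENNReal.ofReal (2 * Real.exp (-(N * s ^ 2 / (2 * B ^ 2)))) ∧
      ∀ ω ∉ E, (∀ i, X i ω ∈ S) ∧ ∀ y k l,
        N ≤ (window (fun i => X i ω) (X k ω) (X l ω)).card →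
        |∑ i ∈ window (fun i => X i ω) (X k ω) (X l ω),
            (max (y - Y i ω) 0 - integratedCdf F (X i ω) y)|
          ≤ (window (fun i => X i ω) (X k ω) (X l ω)).card * (s + 4 * B / n + β) := by
  set D : Fin n → Fin n → Fin (n + 1) → Set Ω := fun k l g =>
    {ω | N ≤ (window (fun i => X i ω) (X k ω) (X l ω)).card ∧
        s * (window (fun i => X i ω) (X k ω) (X l ω)).card
          ≤ |∑ i ∈ window (fun i => X i ω) (X k ω) (X l ω),
              (max (gridPoint n B g - clamp B (Y i ω)) 0
                - clampedCdf F B (X i ω) (gridPoint n B g))|} with hD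
  refine ⟨((⋃ i, {ω | X i ω ∉ S}) ∪ ⋃ i, {ω | B ≤ |Y i ω|}) ∪ ⋃ k, ⋃ l, ⋃ g, D k l g, ?_, ?_⟩
  · have h0 : μ (⋃ i, {ω | X i ω ∉ S}) = 0 := measure_iUnion_null fun i => hS i
    have h1 : μ (⋃ i, {ω | B ≤ |Y i ω|}) ≤ n * ENNReal.ofReal q := by
      refine (measure_iUnion_fintype_le _ _).trans ((Finset.sum_le_card_nsmul _ _ _ fun i _ =>
        measure_response_tail_le hY hX hS hc (fun x hx => (hT x hx).1) i).trans (le_of_eq ?_))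
      simp
    have h2 : μ (⋃ k, ⋃ l, ⋃ g, D k l g)
        ≤ n * n * (n + 1) * ENNReal.ofReal (2 * Real.exp (-(N * s ^ 2 / (2 * B ^ 2)))) := by
      have hone : ∀ k l g, μ (D k l g)
          ≤ ENNReal.ofReal (2 * Real.exp (-(N * s ^ 2 / (2 * B ^ 2)))) := fun k l g =>
        measure_window_deviation_le hY hX hc hB.le hs
          (gridPoint_le hn hB.le (Nat.lt_succ_iff.1 g.2)) k l
      calc μ (⋃ k, ⋃ l, ⋃ g, D k l g) ≤ ∑ k, ∑ l, ∑ g, μ (D k l g) :=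
            (measure_iUnion_fintype_le _ _).trans (Finset.sum_le_sum fun k _ =>
              (measure_iUnion_fintype_le _ _).trans (Finset.sum_le_sum fun l _ =>
                measure_iUnion_fintype_le _ _))
        _ ≤ ∑ _k : Fin n, ∑ _l : Fin n, ∑ _g : Fin (n + 1),
              ENNReal.ofReal (2 * Real.exp (-(N * s ^ 2 / (2 * B ^ 2)))) :=
            Finset.sum_le_sum fun k _ => Finset.sum_le_sum fun l _ =>
              Finset.sum_le_sum fun g _ => hone k l g
        _ = _ := by
            simp
            ring
    calc _ ≤ _ := measure_union_le _ _
      _ ≤ _ := add_le_add (measure_union_le _ _) le_rfl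
      _ ≤ _ := by
        rw [h0, zero_add]
        exact add_le_add h1 h2
  · intro ω hω
    simp only [Set.mem_union, Set.mem_iUnion, not_or, not_exists] at hω
    obtain ⟨⟨hωS, hωY⟩, hωD⟩ := hω
    have hXS : ∀ i, X i ω ∈ S := fun i => by
      by_contra hi
      exact hωS i hi
    refine ⟨hXS, fun y k l hcard => ?_⟩
    set A := window (fun i => X i ω) (X k ω) (X l ω) with hA
    -- Off the event no response reaches `B`, so clamping leaves the data unchanged and affects only
    -- the centering, at a cost of `β` per observation.
    have hYc : ∀ i, clamp B (Y i ω) = Y i ω := fun i => by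
      refine clamp_eq_self ?_
      by_contra! hi
      exact hωY i hi.le
    have h1 := abs_sum_centered_le_of_grid F hn hB A (fun i => X i ω) (fun i => Y i ω) (s := s)
      (fun g hg => by
        by_contra! hlt
        exact hωD k l ⟨g, Nat.lt_succ_iff.2 hg⟩ ⟨hcard, hlt.le⟩) y
    have h2 : |∑ i ∈ A, (max (y - Y i ω) 0 - integratedCdf F (X i ω) y)
        - ∑ i ∈ A, (max (y - Y i ω) 0 - clampedCdf F B (X i ω) y)| ≤ A.card * β := by
      rw [← Finset.sum_sub_distrib]
      refine (Finset.abs_sum_le_sum_abs _ _).trans ?_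
      have := Finset.sum_le_card_nsmul A (fun i => |(max (y - Y i ω) 0
        - integratedCdf F (X i ω) y) - (max (y - Y i ω) 0 - clampedCdf F B (X i ω) y)|)
        β fun i _ => by
          rw [sub_sub_sub_cancel_left, abs_sub_comm]
          exact hT.abs_integratedCdf_sub_clampedCdf_le hB.le (hXS i) y
      simpa using this
    simp only [hYc] at h1
    have h3 := abs_sub_abs_le_abs_sub (∑ i ∈ A, (max (y - Y i ω) 0 - integratedCdf F (X i ω) y))
      (∑ i ∈ A, (max (y - Y i ω) 0 - clampedCdf F B (X i ω) y))
    rw [mul_add]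
    linarith

/-! ### Tail bounds from the conditions (P) and (E) -/

/-- Integrability and mean exceedance from a bound for the tail probabilities. -/
lemma integrable_and_integral_exceedance_le {P : Measure ℝ} [IsFiniteMeasure P] {B : ℝ}
    {T : ℝ → ℝ} (hT0 : ∀ s, B < s → 0 ≤ T s)
    (hTi : IntegrableOn T (Set.Ioi B)) (hT : ∀ s, B < s → P {t | s ≤ |t|} ≤ ENNReal.ofReal (T s)) :
    Integrable (fun t => t) P ∧ ∫ t, max (|t| - B) 0 ∂P ≤ ∫ s in Set.Ioi B, T s := by
  have hm : Measurable fun t : ℝ => max (|t| - B) 0 := by fun_prop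
  have hnn : 0 ≤ᵐ[P] fun t : ℝ => max (|t| - B) 0 := ae_of_all _ fun t => le_max_right _ _
  have hle : ∫⁻ t, ENNReal.ofReal (max (|t| - B) 0) ∂P
      ≤ ENNReal.ofReal (∫ s in Set.Ioi B, T s) := by
    -- Layer cake formula, with the variable shifted by `B`: for `s > 0` the exceedance is at least
    -- `s` only if `|t| ≥ B + s`.
    rw [lintegral_eq_lintegral_meas_le P hnn hm.aemeasurable,
      ofReal_integral_eq_lintegral_ofReal hTi
        ((ae_restrict_iff' measurableSet_Ioi).2 (ae_of_all _ hT0)),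
      ← (measurePreserving_add_left (volume : Measure ℝ) B).setLIntegral_comp_preimage_emb
        (measurableEmbedding_addLeft B) (fun s => ENNReal.ofReal (T s)) (Set.Ioi B),
      Set.preimage_const_add_Ioi, sub_self]
    refine setLIntegral_mono' measurableSet_Ioi fun s hs => ?_
    have hs' : 0 < s := hs
    refine le_trans (measure_mono fun t ht => ?_) (hT (B + s) (by linarith))
    rcases le_max_iff.1 (show s ≤ max (|t| - B) 0 from ht) with h | h
    · show B + s ≤ |t|
      linarith
    · linarith
  have hintg : Integrable (fun t : ℝ => max (|t| - B) 0) P :=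
    ⟨hm.aestronglyMeasurable, by
      rw [hasFiniteIntegral_iff_ofReal hnn]
      exact hle.trans_lt ENNReal.ofReal_lt_top⟩
  constructor
  · refine Integrable.mono' (hintg.add (integrable_const |B|))
      measurable_id.aestronglyMeasurable (ae_of_all _ fun t => ?_)
    have h1 := le_max_left (|t| - B) 0
    have h2 := le_abs_self B
    simp only [Real.norm_eq_abs, Pi.add_apply]
    linarith
  · rw [integral_eq_lintegral_of_nonneg_ae hnn hm.aestronglyMeasurable]
    exact ENNReal.toReal_le_of_le_ofReal (setIntegral_nonneg measurableSet_Ioi hT0) hle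

/-- The mean exceedance is at most `∫ s^(-λ)` over `s > B`, that is `B^(1-λ) / (λ - 1)`; the
denominator is at least `1` because `λ > 2`. -/
lemma ConditionP.tailBound {F : Kernel ℝ ℝ} [IsMarkovKernel F] {S : Set ℝ} {lam : ℝ}
    (h : ConditionP F S lam) :
    ∃ y₀, ∀ B, y₀ ≤ B → 0 < B → TailBound F S B (B ^ (-lam)) (B * B ^ (-lam)) := by
  obtain ⟨hlam, y₀, -, hy⟩ := h
  refine ⟨y₀, fun B hB hB0 x hx => ?_⟩
  have htail : ∀ s, B ≤ s → F x {t | s ≤ |t|} ≤ ENNReal.ofReal (s ^ (-lam)) := fun s hs => by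
    rw [← ENNReal.ofReal_rpow_of_pos (hB0.trans_le hs)]
    exact hy s (hB.trans hs) x hx
  obtain ⟨h1, h2⟩ := integrable_and_integral_exceedance_le (P := F x) (B := B)
    (T := fun s => s ^ (-lam)) (fun s hs => Real.rpow_nonneg (hB0.le.trans hs.le) _)
    (integrableOn_Ioi_rpow_of_lt (by linarith) hB0) (fun s hs => htail s hs.le)
  refine ⟨htail B le_rfl, h1, h2.trans ?_⟩
  rw [integral_Ioi_rpow_of_lt (by linarith) hB0, Real.rpow_add hB0, Real.rpow_one,
    neg_div, ← div_neg, neg_add, neg_neg, mul_comm B]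
  exact div_le_self (mul_nonneg (Real.rpow_nonneg hB0.le _) hB0.le) (by linarith)

lemma ConditionE.tailBound {F : Kernel ℝ ℝ} [IsMarkovKernel F] {S : Set ℝ} {lam : ℝ}
    (h : ConditionE F S lam) :
    ∃ y₀, ∀ B, y₀ ≤ B →
      TailBound F S B (Real.exp (-lam * B)) (Real.exp (-lam * B) / lam) := by
  obtain ⟨hlam, y₀, -, hy⟩ := h
  refine ⟨y₀, fun B hB x hx => ?_⟩
  obtain ⟨h1, h2⟩ := integrable_and_integral_exceedance_le (P := F x) (B := B)
    (T := fun s => Real.exp (-lam * s)) (fun s _ => (Real.exp_pos _).le)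
    (integrableOn_exp_mul_Ioi (by linarith) B) (fun s hs => hy s (hB.trans hs.le) x hx)
  refine ⟨hy B hB x hx, h1, h2.trans (le_of_eq ?_)⟩
  rw [integral_exp_mul_Ioi (by linarith), neg_div_neg_eq]

/-! ### Numbers of covariates in a set -/

/-- Hoeffding's inequality for the number of covariates in a set. -/
lemma measure_card_le_le {Ω : Type*} [MeasurableSpace Ω] {μ : Measure Ω}
    [IsProbabilityMeasure μ] {n : ℕ} {X : Fin n → Ω → ℝ} (hX : ∀ i, Measurable (X i))
    (hind : iIndepFun X μ) {J : Set ℝ} (hJ : MeasurableSet J) [DecidablePred (· ∈ J)] {r e : ℝ}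
    (he : 0 ≤ e)
    (hr : ∀ i, r ≤ μ.real {ω | X i ω ∈ J}) :
    μ {ω | ((Finset.univ.filter fun i => X i ω ∈ J).card : ℝ) ≤ n * (r - e)}
      ≤ ENNReal.ofReal (Real.exp (-(2 * n * e ^ 2))) := by
  -- The negated indicator turns the upper-tail inequality into a bound for the lower tail of the
  -- count.
  have hgm : Measurable fun t : ℝ => -J.indicator (fun _ => (1 : ℝ)) t :=
    (measurable_const.indicator hJ).neg
  have h := measureReal_mul_card_le_sum_sub_integral_le
    (Z := fun i ω => -J.indicator (fun _ => (1 : ℝ)) (X i ω))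
    (hind.comp (fun _ t => -J.indicator (fun _ => (1 : ℝ)) t) fun _ => hgm)
    (fun i => (hgm.comp (hX i)).aemeasurable) (a := -1) (b := 0)
    (fun i ω => by
      by_cases hω : X i ω ∈ J <;> simp [hω]) Finset.univ he
  rw [← ENNReal.ofReal_toReal (measure_ne_top μ _)]
  refine ENNReal.ofReal_le_ofReal (le_trans (measureReal_mono fun ω hω => ?_)
    (h.trans (le_of_eq (by simp))))
  have hintg : ∀ i, ∫ ω', -J.indicator (fun _ => (1 : ℝ)) (X i ω') ∂μ
      = -μ.real {ω | X i ω ∈ J} := fun i => by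
    rw [integral_neg]
    congr 1
    have : (fun ω' => J.indicator (fun _ => (1 : ℝ)) (X i ω'))
        = {ω | X i ω ∈ J}.indicator fun _ => (1 : ℝ) := by
      ext ω'
      simp [Set.indicator]
    rw [this, integral_indicator (show MeasurableSet {ω | X i ω ∈ J} from hX i hJ)]
    simp
  have hcard : ((Finset.univ.filter fun i => X i ω ∈ J).card : ℝ)
      = ∑ i, J.indicator (fun _ => (1 : ℝ)) (X i ω) := by
    simp [Set.indicator]
  have hω' : ((Finset.univ.filter fun i => X i ω ∈ J).card : ℝ) ≤ n * (r - e) := hω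
  have hsum : n * r ≤ ∑ i, μ.real {ω | X i ω ∈ J} := by
    have := Finset.card_nsmul_le_sum Finset.univ (fun i => μ.real {ω | X i ω ∈ J}) r
      fun i _ => hr i
    simpa using this
  show e * (Finset.univ : Finset (Fin n)).card ≤ _
  simp only [hintg, sub_neg_eq_add, Finset.sum_add_distrib, Finset.sum_neg_distrib, ← hcard,
    Finset.card_univ, Fintype.card_fin]
  linarith

/-- A density that is at least `p` on `I` bounds the probability of subintervals from below. -/
lemma le_measureReal_of_density {Ω : Type*} [MeasurableSpace Ω] {μ : Measure Ω}
    [IsProbabilityMeasure μ] {X : Ω → ℝ} (hX : Measurable X) {I : Set ℝ} {p : ℝ} (hp : 0 ≤ p)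
    {f : ℝ → ℝ≥0∞} (hf : μ.map X = volume.withDensity f)
    (hfI : ∀ x ∈ I, ENNReal.ofReal p ≤ f x) {a b : ℝ} (hI : Set.Icc a b ⊆ I) :
    p * (b - a) ≤ μ.real {ω | X ω ∈ Set.Icc a b} := by
  have h1 : μ {ω | X ω ∈ Set.Icc a b} = ∫⁻ x in Set.Icc a b, f x := by
    rw [← withDensity_apply _ measurableSet_Icc, ← hf, Measure.map_apply hX measurableSet_Icc]
    rfl
  have h2 : ENNReal.ofReal (p * (b - a)) ≤ μ {ω | X ω ∈ Set.Icc a b} := by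
    rw [h1, ENNReal.ofReal_mul hp, ← Real.volume_Icc, ← setLIntegral_const]
    exact setLIntegral_mono' measurableSet_Icc fun x hx => hfI x (hI hx)
  exact (ENNReal.ofReal_le_iff_le_toReal (measure_ne_top μ _)).1 h2

/-! ### Asymptotic deviation bound and reduction of condition (A) -/

/-- The stochastic error of a mean of about `n p` responses in `[-B, B]`. -/
noncomputable def stochasticError (B p : ℝ) (n : ℕ) : ℝ := B * √(Real.log n / (n * p))

/-- Asymptotic form of the uniform deviation bound. -/
lemma IsSamplingModel.exists_deviation_events {Ω : Type*} [MeasurableSpace Ω] {μ : Measure Ω}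
    [IsProbabilityMeasure μ] {X Y : (n : ℕ) → Fin n → Ω → ℝ} {F : Kernel ℝ ℝ} [IsMarkovKernel F]
    {S : Set ℝ} (hmodel : IsSamplingModel μ X Y F S) {B p q β : ℕ → ℝ} {C : ℝ}
    (hB : ∀ᶠ n in atTop, 0 < B n) (hp : ∀ᶠ n in atTop, 0 < p n) (hpC : ∀ᶠ n in atTop, p n ≤ C)
    (hT : ∀ᶠ n in atTop, TailBound F S (B n) (q n) (β n))
    (hβ : ∀ᶠ n : ℕ in atTop, β n ≤ B n / n)
    (hq : Tendsto (fun n : ℕ => n * q n) atTop (𝓝 0)) :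
    ∃ E : ℕ → Set Ω, Tendsto (fun n => μ (E n)) atTop (𝓝 0) ∧
      ∀ᶠ n : ℕ in atTop, ∀ ω ∉ E n, (∀ i, X n i ω ∈ S) ∧ ∀ y k l,
        3 / 4 * (n * p n) ≤ (window (fun i => X n i ω) (X n k ω) (X n l ω)).card →
        |∑ i ∈ window (fun i => X n i ω) (X n k ω) (X n l ω),
            (max (y - Y n i ω) 0 - integratedCdf F (X n i ω) y)|
          ≤ (window (fun i => X n i ω) (X n k ω) (X n l ω)).card
            * (15 / 4 * stochasticError (B n) (p n) n) := by
  have hlog : Tendsto (fun n : ℕ => Real.log n) atTop atTop :=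
    Real.tendsto_log_atTop.comp tendsto_natCast_atTop_atTop
  have hlarge : ∀ᶠ n : ℕ in atTop, 400 * C ≤ n :=
    tendsto_natCast_atTop_atTop.eventually_ge_atTop _
  have key : ∀ᶠ n : ℕ in atTop, ∃ E : Set Ω,
      μ E ≤ ENNReal.ofReal (n * q n) + ENNReal.ofReal (4 * (n : ℝ)⁻¹) ∧
      ∀ ω ∉ E, (∀ i, X n i ω ∈ S) ∧ ∀ y k l,
        3 / 4 * (n * p n) ≤ (window (fun i => X n i ω) (X n k ω) (X n l ω)).card →
        |∑ i ∈ window (fun i => X n i ω) (X n k ω) (X n l ω),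
            (max (y - Y n i ω) 0 - integratedCdf F (X n i ω) y)|
          ≤ (window (fun i => X n i ω) (X n k ω) (X n l ω)).card
            * (15 / 4 * stochasticError (B n) (p n) n) := by
    filter_upwards [hB, hp, hpC, hT, hβ, hlarge, eventually_ge_atTop 1,
      hlog.eventually_ge_atTop 1] with n hB hp hpC hT hβ hlarge hn hlog1
    have hn' : (1 : ℝ) ≤ n := by exact_mod_cast hn
    have hn0 : (0 : ℝ) < n := by linarith
    set D := stochasticError (B n) (p n) n with hD
    have hD0 : 0 ≤ D := mul_nonneg hB.le (Real.sqrt_nonneg _)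
    have hDsq : D ^ 2 = B n ^ 2 * (Real.log n / (n * p n)) := by
      rw [hD, stochasticError, mul_pow, Real.sq_sqrt]
      positivity
    -- With these constants the Hoeffding exponent is `(147/32) log n ≥ 4 log n`, which beats the
    -- roughly `n³` events of the union bound. The total `15/4` leaves room below the constant `4`
    -- of the theorem.
    obtain ⟨E, hE, hEω⟩ := exists_deviation_event (N := 3 / 4 * (n * p n)) (s := 7 / 2 * D)
      (Nat.pos_of_ne_zero (by omega)) (hmodel.measurable_response n)
      (hmodel.measurable_covariate n) (hmodel.covariate_mem n) (hmodel.condLaw_response n) hB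
      (by positivity) hT
    refine ⟨E, hE.trans (add_le_add ?_ ?_), fun ω hω => ⟨(hEω ω hω).1, fun y k l hc =>
      ((hEω ω hω).2 y k l hc).trans (mul_le_mul_of_nonneg_left ?_ (Nat.cast_nonneg _))⟩⟩
    · rw [ENNReal.ofReal_mul hn0.le, ENNReal.ofReal_natCast]
    · have hexp : Real.exp (-(3 / 4 * (n * p n) * (7 / 2 * D) ^ 2 / (2 * B n ^ 2)))
          ≤ ((n : ℝ) ^ 4)⁻¹ := by
        have h1 : 3 / 4 * (n * p n) * (7 / 2 * D) ^ 2 / (2 * B n ^ 2)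
            = 147 / 32 * Real.log n := by
          rw [mul_pow, hDsq]
          field_simp
          norm_num
        have h2 : ((n : ℝ) ^ 4)⁻¹ = Real.exp (-(4 * Real.log n)) := by
          rw [Real.exp_neg, ← Real.rpow_natCast, Real.rpow_def_of_pos hn0]
          congr 2
          push_cast
          ring
        rw [h1, h2]
        exact Real.exp_le_exp.2 (by linarith)
      have h3 : (n : ℝ≥0∞) * n * (n + 1) = ENNReal.ofReal (n * n * (n + 1)) := by
        rw [ENNReal.ofReal_mul (by positivity), ENNReal.ofReal_mul (by positivity),
          ENNReal.ofReal_add (by positivity) zero_le_one, ENNReal.ofReal_natCast,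
          ENNReal.ofReal_one]
      rw [h3, ← ENNReal.ofReal_mul (by positivity)]
      refine ENNReal.ofReal_le_ofReal ?_
      calc (n * n * (n + 1) : ℝ)
            * (2 * Real.exp (-(3 / 4 * (n * p n) * (7 / 2 * D) ^ 2 / (2 * B n ^ 2))))
          ≤ n * n * (n + n) * (2 * ((n : ℝ) ^ 4)⁻¹) := by gcongr
        _ = 4 * (n : ℝ)⁻¹ := by
          field_simp
          norm_num
    -- Grid error `4B/n` and clamping bias `β ≤ B/n` add up to `5B/n ≤ D/4`, and `7/2 + 1/4 = 15/4`.
    · have h20 : 20 / n ≤ √(Real.log n / (n * p n)) := by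
        refine Real.le_sqrt_of_sq_le ?_
        rw [div_pow, div_le_div_iff₀ (by positivity) (by positivity)]
        nlinarith [mul_le_mul_of_nonneg_left hlog1 (by positivity : (0 : ℝ) ≤ n ^ 2),
          mul_le_mul_of_nonneg_left (hpC) hn0.le, mul_le_mul_of_nonneg_left hlarge hn0.le]
      have h5 : 20 * (B n / n) ≤ D := by
        calc 20 * (B n / n) = B n * (20 / n) := by ring
          _ ≤ D := by
            rw [hD, stochasticError]
            gcongr
      rw [mul_div_assoc]
      linarith
  obtain ⟨E, hE⟩ := key.choice
  refine ⟨E, ?_, hE.mono fun n hn => hn.2⟩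
  have hlim : Tendsto (fun n : ℕ => ENNReal.ofReal (n * q n) + ENNReal.ofReal (4 * (n : ℝ)⁻¹))
      atTop (𝓝 0) := by
    have h1 := ENNReal.tendsto_ofReal hq
    have h2 := ENNReal.tendsto_ofReal
      ((tendsto_inv_atTop_zero.comp (tendsto_natCast_atTop_atTop (R := ℝ))).const_mul 4)
    simpa using h1.add h2
  exact tendsto_of_tendsto_of_tendsto_of_le_of_le' tendsto_const_nhds hlim
    (Eventually.of_forall fun n => zero_le) (hE.mono fun n hn => hn.1)

/-- A uniform bound outside of events with vanishing probability gives condition (A). -/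
lemma conditionA_of_events {Ω : Type*} [MeasurableSpace Ω] {μ : Measure Ω} {F : Kernel ℝ ℝ}
    {m : ℕ → Ω → ℝ → ℝ → ℝ} {c c' : ℕ → ℝ} {I : ℕ → Set ℝ} {E : ℕ → Set Ω} (hc : ∀ n, 0 ≤ c n)
    (hE : Tendsto (fun n => μ (E n)) atTop (𝓝 0))
    (hcc : ∀ᶠ n in atTop, 0 ≤ c' n ∧ c' n < c n)
    (h : ∀ᶠ n in atTop, ∀ ω ∉ E n, ∀ y, ∀ x ∈ I n, |m n ω x y - integratedCdf F x y| ≤ c' n) :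
    ConditionA μ F m c I := by
  refine ⟨hc, tendsto_of_tendsto_of_tendsto_of_le_of_le' tendsto_const_nhds hE
    (Eventually.of_forall fun n => zero_le) ?_⟩
  filter_upwards [hcc, h] with n hcc h
  refine measure_mono fun ω hω => ?_
  by_contra hωE
  have h1 : ⨆ (y : ℝ) (x ∈ I n), ENNReal.ofReal |m n ω x y - integratedCdf F x y|
      ≤ ENNReal.ofReal (c' n) :=
    iSup_le fun y => iSup₂_le fun x hx => ENNReal.ofReal_le_ofReal (h ω hωE y x hx)
  -- Strictness matters: the bad event includes equality of the supremum with `c n`.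
  have h2 : ENNReal.ofReal (c' n) < ENNReal.ofReal (c n) :=
    (ENNReal.ofReal_lt_ofReal_iff (hcc.1.trans_lt hcc.2)).2 hcc.2
  exact absurd (lt_of_le_of_lt h1 h2) (not_lt.2 hω)

lemma IsSamplingModel.integratedCdf_le {Ω : Type*} [MeasurableSpace Ω] {μ : Measure Ω}
    [IsProbabilityMeasure μ] {X Y : (n : ℕ) → Fin n → Ω → ℝ} {F : Kernel ℝ ℝ} [IsMarkovKernel F]
    {S : Set ℝ} (hmodel : IsSamplingModel μ X Y F S) {B q β : ℝ} (hT : TailBound F S B q β)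
    (y : ℝ) : ∀ a ∈ S, ∀ b ∈ S, a ≤ b → integratedCdf F b y ≤ integratedCdf F a y :=
  fun a ha b hb hab => integratedCdf_le_of_icvLE (hmodel.icv_increasing a ha b hb hab)
    (hT a ha).2.1 (hT b hb).2.1 y

/-- Union bound for the covariate counts: at most `a u + b` sets, each failing with probability at
most `exp (-c u)`. It serves with `u = n` for levels and `u = n^(1/3)` for densities. -/
lemma tendsto_ofReal_exp_neg_mul {c : ℝ} (hc : 0 < c) (a b : ℝ) {u : ℕ → ℝ}
    (hu : Tendsto u atTop atTop) :
    Tendsto (fun n => ENNReal.ofReal ((a * u n + b) * Real.exp (-(c * u n)))) atTop (𝓝 0) := by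
  have h0 := Real.tendsto_pow_mul_exp_neg_atTop_nhds_zero
  have hcu : Tendsto (fun n => c * u n) atTop atTop := hu.const_mul_atTop hc
  have h1 := ((h0 1).comp hcu).const_mul (a / c)
  have h2 := ((h0 0).comp hcu).const_mul b
  have h3 := ENNReal.tendsto_ofReal (h1.add h2)
  simp only [mul_zero, add_zero, ENNReal.ofReal_zero] at h3
  refine h3.congr fun n => ?_
  congr 1
  simp only [Function.comp_apply, pow_one, pow_zero, one_mul]
  field_simp

/-! ### Finitely many levels -/

/-- Condition (A) in the case of finitely many levels. -/
lemma conditionA_of_levels {Ω : Type*} [MeasurableSpace Ω] {μ : Measure Ω}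
    [IsProbabilityMeasure μ] {X Y : (n : ℕ) → Fin n → Ω → ℝ} {F : Kernel ℝ ℝ} [IsMarkovKernel F]
    {Mt : ℕ → Ω → ℝ → ℝ → ℝ}
    (hMt : ∀ n ω, IsEstimator (fun i => X n i ω) (fun i => Y n i ω) (Mt n ω))
    {K : ℕ} {p : ℝ} (hmodel : IsSamplingModel μ X Y F (levels K)) (hK : ConditionK μ X K p)
    {B q β c : ℕ → ℝ} (hB : ∀ᶠ n in atTop, 0 < B n)
    (hT : ∀ᶠ n in atTop, TailBound F (levels K) (B n) (q n) (β n))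
    (hβ : ∀ᶠ n : ℕ in atTop, β n ≤ B n / n)
    (hq : Tendsto (fun n : ℕ => n * q n) atTop (𝓝 0)) (hc0 : ∀ n, 0 ≤ c n)
    (hc : ∀ᶠ n in atTop, c n = 4 * stochasticError (B n) p n) :
    ConditionA μ F Mt c (fun _ => levels K) := by
  obtain ⟨hp, hK⟩ := hK
  obtain ⟨E, hE, hEω⟩ := hmodel.exists_deviation_events (p := fun _ => p) (C := p) hB
    (Eventually.of_forall fun _ => hp) (Eventually.of_forall fun _ => le_rfl) hT hβ hq
  -- Some level has at most `3/4` of the guaranteed `n p` observations.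
  set E' : ℕ → Set Ω := fun n => ⋃ j ∈ Finset.Icc 1 K,
    {ω | ((Finset.univ.filter fun i => X n i ω ∈ ({(j : ℝ)} : Set ℝ)).card : ℝ)
      ≤ n * (p - p / 4)} with hE'
  have hE'lim : Tendsto (fun n => μ (E' n)) atTop (𝓝 0) := by
    have h1 : ∀ n, μ (E' n) ≤ ENNReal.ofReal ((0 * (n : ℝ) + K)
        * Real.exp (-(p ^ 2 / 8 * n))) := fun n => by
      rw [zero_mul, zero_add, ENNReal.ofReal_mul (Nat.cast_nonneg _), ENNReal.ofReal_natCast]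
      refine (measure_biUnion_finset_le _ _).trans ((Finset.sum_le_card_nsmul _ _
        (ENNReal.ofReal (Real.exp (-(p ^ 2 / 8 * n)))) fun j hj => ?_).trans (by simp))
      refine (measure_card_le_le (hmodel.measurable_covariate n) (hmodel.indep_covariate n)
        (measurableSet_singleton (j : ℝ)) (r := p) (e := p / 4) (by positivity)
        fun i => ?_).trans (le_of_eq ?_)
      · exact hK n i j ⟨j, (Finset.mem_Icc.1 hj).1, (Finset.mem_Icc.1 hj).2, rfl⟩
      · congr 3
        ring
    exact tendsto_of_tendsto_of_tendsto_of_le_of_le tendsto_const_nhds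
      (tendsto_ofReal_exp_neg_mul (by positivity) 0 K tendsto_natCast_atTop_atTop)
      (fun n => zero_le) h1
  have hlog : Tendsto (fun n : ℕ => Real.log n) atTop atTop :=
    Real.tendsto_log_atTop.comp tendsto_natCast_atTop_atTop
  refine conditionA_of_events (E := fun n => E n ∪ E' n)
    (c' := fun n => 15 / 4 * stochasticError (B n) p n) hc0 ?_ ?_ ?_
  · refine tendsto_of_tendsto_of_tendsto_of_le_of_le tendsto_const_nhds
      (by simpa using hE.add hE'lim) (fun n => zero_le) fun n => measure_union_le _ _
  · filter_upwards [hB, hc, hlog.eventually_ge_atTop 1, eventually_ge_atTop 1]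
      with n hB hc hlog hn
    have hn' : (0 : ℝ) < n := by exact_mod_cast hn
    have : 0 < stochasticError (B n) p n :=
      mul_pos hB (Real.sqrt_pos.2 (by positivity))
    exact ⟨by positivity, by rw [hc]; linarith⟩
  · filter_upwards [hEω, hT, eventually_ge_atTop 1] with n hEω hT hn ω hω y x hx
    have hn' : (0 : ℝ) < n := by exact_mod_cast hn
    simp only [Set.mem_union, not_or] at hω
    obtain ⟨hXS, hdev⟩ := hEω ω hω.1
    -- The degenerate window `[x, x]` already holds enough observations, so there is no bias.
    have hcard : 3 / 4 * (n * p) ≤ (window (fun i => X n i ω) x x).card := by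
      obtain ⟨j, hj1, hjK, rfl⟩ := hx
      by_contra! hlt
      refine hω.2 (Set.mem_biUnion (Finset.mem_coe.2 (Finset.mem_Icc.2 ⟨hj1, hjK⟩)) ?_)
      have hw : (Finset.univ.filter fun i => X n i ω ∈ ({(j : ℝ)} : Set ℝ))
          = window (fun i => X n i ω) j j := by
        ext i
        simp [le_antisymm_iff, and_comm]
      show ((Finset.univ.filter fun i => X n i ω ∈ ({(j : ℝ)} : Set ℝ)).card : ℝ)
        ≤ n * (p - p / 4)
      rw [hw]
      linarith
    have hN : 0 < 3 / 4 * (n * p) := by positivity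
    have hmono := hmodel.integratedCdf_le hT y
    have h1 := (hMt n ω).le_add_of_window hXS hmono hN (hdev y) hx hcard
    have h2 := (hMt n ω).sub_le_of_window hXS hmono hN (hdev y) hx hcard
    rw [abs_le]
    constructor <;> linarith

/-! ### Covariates with a density -/

/-- An interval of length `δ` to the right of `a` contains a grid interval of length `7 δ / 8`. -/
lemma exists_grid_Icc_subset {a z δ R : ℝ} (hδ : 0 < δ) (haz : a ≤ z) (hz : z ≤ a + R) :
    ∃ k < ⌈8 * R / δ⌉₊ + 1, Set.Icc (a + k * (δ / 8)) (a + k * (δ / 8) + 7 / 8 * δ)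
      ⊆ Set.Icc z (z + δ) := by
  set r := (z - a) / (δ / 8) with hr
  have hr0 : 0 ≤ r := div_nonneg (by linarith) (by linarith)
  have hrz : r * (δ / 8) = z - a := div_mul_cancel₀ _ (by positivity)
  have h1 := Nat.le_ceil r
  have h2 := Nat.ceil_lt_add_one hr0
  -- The first grid point at or after `z` is less than `δ/8` away, which leaves room for length
  -- `7δ/8`.
  refine ⟨⌈r⌉₊, Nat.lt_succ_of_le (Nat.ceil_mono ?_), Set.Icc_subset_Icc ?_ ?_⟩
  · rw [hr, div_le_div_iff₀ (by positivity) hδ]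
    nlinarith
  · nlinarith
  · nlinarith

/-- Condition (A) in the case of covariates with a density. -/
lemma conditionA_of_density {Ω : Type*} [MeasurableSpace Ω] {μ : Measure Ω}
    [IsProbabilityMeasure μ] {X Y : (n : ℕ) → Fin n → Ω → ℝ} {F : Kernel ℝ ℝ} [IsMarkovKernel F]
    {Mt : ℕ → Ω → ℝ → ℝ → ℝ}
    (hMt : ∀ n ω, IsEstimator (fun i => X n i ω) (fun i => Y n i ω) (Mt n ω))
    {S I : Set ℝ} {p L : ℝ} (hIS : I ⊆ S) (hmodel : IsSamplingModel μ X Y F S)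
    (hC1 : ConditionC1 μ X I p) (hC2 : ConditionC2 F I L)
    {B q β c δ : ℕ → ℝ} (hB : ∀ᶠ n in atTop, 1 ≤ B n)
    (hT : ∀ᶠ n in atTop, TailBound F S (B n) (q n) (β n))
    (hβ : ∀ᶠ n : ℕ in atTop, β n ≤ B n / n)
    (hq : Tendsto (fun n : ℕ => n * q n) atTop (𝓝 0)) (hc0 : ∀ n, 0 ≤ c n)
    (hδ0 : ∀ᶠ n in atTop, 0 < δ n) (hδ1 : ∀ᶠ n in atTop, δ n ≤ 1)
    (hδ : ∀ᶠ n : ℕ in atTop, δ n ^ 3 = B n ^ 2 * Real.log n / n)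
    (hc : ∀ᶠ n in atTop, c n = (4 * p ^ (-1 / 2 : ℝ) + L) * δ n) :
    ConditionA μ F Mt c (fun n => interiorPart I (δ n)) := by
  classical
  obtain ⟨hp, hI, hdens⟩ := hC1
  obtain ⟨hL, hlip⟩ := hC2
  have hB0 : ∀ᶠ n in atTop, 0 < B n := hB.mono fun n hn => by linarith
  obtain ⟨E, hE, hEω⟩ := hmodel.exists_deviation_events (p := fun n => p * δ n) (C := p) hB0
    (hδ0.mono fun n hn => mul_pos hp hn)
    (hδ1.mono fun n hn => mul_le_of_le_one_right hp.le hn) hT hβ hq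
  have hlog : Tendsto (fun n : ℕ => Real.log n) atTop atTop :=
    Real.tendsto_log_atTop.comp tendsto_natCast_atTop_atTop
  have hp2 : 0 < p ^ (-1 / 2 : ℝ) := Real.rpow_pos_of_pos hp _
  -- The relation `δ³ = B² log n / n` is exactly what makes the noise with `n p δ` observations a
  -- multiple of `δ`.
  have herr : ∀ᶠ n : ℕ in atTop, stochasticError (B n) (p * δ n) n = p ^ (-1 / 2 : ℝ) * δ n := by
    filter_upwards [hB0, hδ0, hδ, eventually_ge_atTop 1] with n hB hδ0 hδ hn
    have hn' : (0 : ℝ) < n := by exact_mod_cast hn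
    have hsq : (p ^ (-1 / 2 : ℝ)) ^ 2 = p⁻¹ := by
      rw [← Real.rpow_natCast, ← Real.rpow_mul hp.le, ← Real.rpow_neg_one]
      norm_num
    have h1 : B n ^ 2 * (Real.log n / (n * (p * δ n))) = (p ^ (-1 / 2 : ℝ) * δ n) ^ 2 := by
      rw [mul_pow, hsq]
      have : B n ^ 2 * (Real.log n / (n * (p * δ n))) = (B n ^ 2 * Real.log n / n) / (p * δ n) := by
        field_simp
      rw [this, ← hδ]
      field_simp
    rw [stochasticError, ← Real.sqrt_sq hB.le, ← Real.sqrt_mul (by positivity),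
      h1, Real.sqrt_sq (by positivity)]
  -- This keeps the number of grid intervals of order `n^(1/3)` and gives `n δ² ≥ n^(1/3)` in the
  -- Hoeffding exponent.
  have hδn : ∀ᶠ n : ℕ in atTop, ((n : ℝ) ^ (1 / 3 : ℝ))⁻¹ ≤ δ n := by
    filter_upwards [hB, hδ0, hδ, eventually_ge_atTop 1, hlog.eventually_ge_atTop 1]
      with n hB hδ0 hδ hn hlog
    have hn' : (0 : ℝ) < n := by exact_mod_cast hn
    refine le_of_pow_le_pow_left₀ three_ne_zero hδ0.le ?_
    rw [hδ, inv_pow, ← Real.rpow_natCast, ← Real.rpow_mul hn'.le]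
    norm_num
    rw [← one_div]
    gcongr
    nlinarith
  rcases I.eq_empty_or_nonempty with hIe | ⟨x₀, hx₀⟩
  · refine conditionA_of_events (E := fun _ => ∅) (c' := fun _ => 0) hc0 (by simp) ?_ ?_
    · filter_upwards [hc, hδ0] with n hc hδ0
      exact ⟨le_rfl, by rw [hc]; positivity⟩
    · refine Eventually.of_forall fun n ω _ y x hx => ?_
      rw [hIe] at hx
      exact absurd hx.1 (Set.notMem_empty x)
  have hprob : ∀ n i a b, Set.Icc a b ⊆ I → p * (b - a) ≤ μ.real {ω | X n i ω ∈ Set.Icc a b} := by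
    intro n i a b hab
    obtain ⟨f, -, hf, hfI⟩ := hdens n i
    exact le_measureReal_of_density (hmodel.measurable_covariate n i) hp.le hf hfI hab
  -- A density of at least `p` on `I` has mass at most one, so `I` is bounded and a finite grid on
  -- `[x₀ - 1/p, x₀ + 1/p]` covers it.
  have hlen : ∀ a ∈ I, ∀ b ∈ I, b - a ≤ 1 / p := by
    intro a ha b hb
    have h1 := (hprob 1 0 a b (hI.out ha hb)).trans measureReal_le_one
    rw [le_div_iff₀ hp]
    linarith
  set a := x₀ - 1 / p with ha
  set J : ℕ → ℕ → Set ℝ := fun n k =>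
    Set.Icc (a + k * (δ n / 8)) (a + k * (δ n / 8) + 7 / 8 * δ n) with hJ
  -- A finite family of deterministic intervals replaces all windows of length `δ`. Only those
  -- inside `I` count, where the density is bounded below; `7/8 - 1/8 = 3/4` matches the window size
  -- in the deviation bound.
  set E' : ℕ → Set Ω := fun n =>
    ⋃ k ∈ (Finset.range (⌈8 * (2 / p) / δ n⌉₊ + 1)).filter fun k => J n k ⊆ I,
    {ω | ((Finset.univ.filter fun i => X n i ω ∈ J n k).card : ℝ)
      ≤ n * (7 / 8 * (p * δ n) - p * δ n / 8)} with hE'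
  have hE'lim : Tendsto (fun n => μ (E' n)) atTop (𝓝 0) := by
    have hcube : Tendsto (fun n : ℕ => (n : ℝ) ^ (1 / 3 : ℝ)) atTop atTop :=
      (tendsto_rpow_atTop (by norm_num)).comp tendsto_natCast_atTop_atTop
    have h1 : ∀ᶠ n : ℕ in atTop, μ (E' n) ≤ ENNReal.ofReal
        ((16 / p * (n : ℝ) ^ (1 / 3 : ℝ) + 2)
          * Real.exp (-(p ^ 2 / 32 * (n : ℝ) ^ (1 / 3 : ℝ)))) := by
      filter_upwards [hδ0, hδn, eventually_ge_atTop 1] with n hδ0 hδn hn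
      have hn' : (0 : ℝ) < n := by exact_mod_cast hn
      set u := (n : ℝ) ^ (1 / 3 : ℝ) with hu
      have hu0 : 0 < u := Real.rpow_pos_of_pos hn' _
      have hu3 : u ^ 3 = n := by
        rw [hu, ← Real.rpow_natCast, ← Real.rpow_mul hn'.le]
        norm_num
      have hone : ∀ k ∈ (Finset.range (⌈8 * (2 / p) / δ n⌉₊ + 1)).filter fun k => J n k ⊆ I,
          μ {ω | ((Finset.univ.filter fun i => X n i ω ∈ J n k).card : ℝ)
            ≤ n * (7 / 8 * (p * δ n) - p * δ n / 8)}
          ≤ ENNReal.ofReal (Real.exp (-(p ^ 2 / 32 * u))) := by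
        intro k hk
        refine (measure_card_le_le (hmodel.measurable_covariate n) (hmodel.indep_covariate n)
          measurableSet_Icc (by positivity) fun i => ?_).trans (ENNReal.ofReal_le_ofReal ?_)
        · refine le_trans (le_of_eq ?_) (hprob n i _ _ (Finset.mem_filter.1 hk).2)
          ring
        · refine Real.exp_le_exp.2 (neg_le_neg ?_)
          have h2 : u ≤ n * δ n ^ 2 := by
            calc u = n * u⁻¹ ^ 2 := by
                  rw [← hu3]
                  field_simp
              _ ≤ n * δ n ^ 2 := by gcongr
          calc p ^ 2 / 32 * u ≤ p ^ 2 / 32 * (n * δ n ^ 2) := by gcongr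
            _ = 2 * n * (p * δ n / 8) ^ 2 := by ring
      have hcount : ((((Finset.range (⌈8 * (2 / p) / δ n⌉₊ + 1)).filter
          fun k => J n k ⊆ I).card : ℕ) : ℝ) ≤ 16 / p * u + 2 := by
        have h3 : (((Finset.range (⌈8 * (2 / p) / δ n⌉₊ + 1)).filter
            fun k => J n k ⊆ I).card : ℝ) ≤ (⌈8 * (2 / p) / δ n⌉₊ + 1 : ℕ) := by
          exact_mod_cast (Finset.card_filter_le _ _).trans (Finset.card_range _).le
        have h4 := Nat.ceil_lt_add_one (a := 8 * (2 / p) / δ n) (by positivity)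
        have h5 : 8 * (2 / p) / δ n ≤ 16 / p * u := by
          rw [div_le_iff₀ hδ0]
          have : 1 ≤ u * δ n := by
            rwa [inv_le_iff_one_le_mul₀ hu0, mul_comm] at hδn
          calc 8 * (2 / p) = 16 / p * 1 := by ring
            _ ≤ 16 / p * (u * δ n) := by gcongr
            _ = 16 / p * u * δ n := by ring
        push_cast at h3
        linarith
      refine (measure_biUnion_finset_le _ _).trans
        ((Finset.sum_le_card_nsmul _ _ _ hone).trans ?_)
      rw [nsmul_eq_mul, ENNReal.ofReal_mul (by positivity), ← ENNReal.ofReal_natCast]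
      gcongr
    exact tendsto_of_tendsto_of_tendsto_of_le_of_le' tendsto_const_nhds
      (tendsto_ofReal_exp_neg_mul (by positivity) (16 / p) 2 hcube)
      (Eventually.of_forall fun n => zero_le) h1
  refine conditionA_of_events (E := fun n => E n ∪ E' n)
    (c' := fun n => (15 / 4 * p ^ (-1 / 2 : ℝ) + L) * δ n) hc0 ?_ ?_ ?_
  · refine tendsto_of_tendsto_of_tendsto_of_le_of_le tendsto_const_nhds
      (by simpa using hE.add hE'lim) (fun n => zero_le) fun n => measure_union_le _ _
  · filter_upwards [hδ0, hc] with n hδ0 hc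
    refine ⟨by positivity, ?_⟩
    rw [hc]
    gcongr
    norm_num
  · filter_upwards [hEω, hT, eventually_ge_atTop 1, hδ0, herr]
      with n hEω hT hn hδ0 herr ω hω y x hx
    have hn' : (0 : ℝ) < n := by exact_mod_cast hn
    simp only [Set.mem_union, not_or] at hω
    obtain ⟨hXS, hdev⟩ := hEω ω hω.1
    obtain ⟨hxI, hxl, hxr⟩ := hx
    have hcard : ∀ z ∈ I, z + δ n ∈ I →
        3 / 4 * (n * (p * δ n)) ≤ (window (fun i => X n i ω) z (z + δ n)).card := by
      intro z hz hzδ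
      obtain ⟨k, hk, hksub⟩ := exists_grid_Icc_subset (a := a) (z := z) (R := 2 / p) hδ0
        (by linarith [hlen z hz x₀ hx₀])
        (by
          have := hlen x₀ hx₀ z hz
          rw [show 2 / p = 1 / p + 1 / p by ring]
          linarith)
      by_contra! hlt
      refine hω.2 (Set.mem_biUnion (Finset.mem_coe.2 (Finset.mem_filter.2
        ⟨Finset.mem_range.2 hk, hksub.trans (hI.out hz hzδ)⟩)) ?_)
      have hw : (Finset.univ.filter fun i => X n i ω ∈ J n k)
          ⊆ window (fun i => X n i ω) z (z + δ n) := fun i hi =>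
        mem_window.2 (hksub (Finset.mem_filter.1 hi).2)
      have hw' : ((Finset.univ.filter fun i => X n i ω ∈ J n k).card : ℝ)
          ≤ (window (fun i => X n i ω) z (z + δ n)).card := by
        exact_mod_cast Finset.card_le_card hw
      show ((Finset.univ.filter fun i => X n i ω ∈ J n k).card : ℝ)
        ≤ n * (7 / 8 * (p * δ n) - p * δ n / 8)
      linarith
    have hN : 0 < 3 / 4 * (n * (p * δ n)) := by positivity
    have hmono := hmodel.integratedCdf_le hT y
    -- Comparison with `x - δ` and `x + δ`, both in `I`; the Lipschitz condition bounds the bias by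
    -- `L δ` on each side.
    have hl := hcard (x - δ n) hxl (by simpa using hxI)
    rw [sub_add_cancel] at hl
    have h1 := (hMt n ω).le_add_of_window hXS hmono hN (hdev y) (hIS hxl) hl
    have h2 := (hMt n ω).sub_le_of_window hXS hmono hN (hdev y) (hIS hxr) (hcard x hxI hxr)
    have h3 := (abs_le.1 (hlip (x - δ n) hxl x hxI y)).2
    have h4 := (abs_le.1 (hlip (x + δ n) hxr x hxI y)).1
    rw [sub_sub_cancel_left, abs_neg, abs_of_pos hδ0] at h3
    rw [add_sub_cancel_left, abs_of_pos hδ0] at h4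
    rw [herr] at h1 h2
    rw [abs_le]
    constructor <;> linarith

/-! ### Truncation levels and powers of the logarithm -/

lemma tendsto_log_natCast_atTop : Tendsto (fun n : ℕ => Real.log n) atTop atTop :=
  Real.tendsto_log_atTop.comp tendsto_natCast_atTop_atTop

/-- Under power tails, `(n log n) ^ (1 / λ)` is a suitable truncation level. -/
lemma ConditionP.exists_truncation {F : Kernel ℝ ℝ} [IsMarkovKernel F] {S : Set ℝ} {lam : ℝ}
    (h : ConditionP F S lam) {B : ℕ → ℝ} (hB : B = fun n : ℕ => (n * Real.log n) ^ (1 / lam)) :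
    ∃ q β : ℕ → ℝ, (∀ᶠ n in atTop, 1 ≤ B n) ∧ (∀ᶠ n in atTop, TailBound F S (B n) (q n) (β n)) ∧
      (∀ᶠ n : ℕ in atTop, β n ≤ B n / n) ∧ Tendsto (fun n : ℕ => n * q n) atTop (𝓝 0) := by
  have hlam : 0 < lam := by linarith [h.1]
  have hBt : Tendsto B atTop atTop := by
    rw [hB]
    exact (tendsto_rpow_atTop (by positivity)).comp
      (tendsto_natCast_atTop_atTop.atTop_mul_atTop₀ tendsto_log_natCast_atTop)
  -- Hence `n q = 1 / log n → 0` and `β = B / (n log n) ≤ B / n`; the logarithm in `B` is there for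
  -- the first of these.
  have hpow : ∀ᶠ n : ℕ in atTop, B n ^ (-lam) = (n * Real.log n)⁻¹ := by
    filter_upwards [tendsto_log_natCast_atTop.eventually_ge_atTop 1] with n hn
    have : 0 ≤ n * Real.log n := by positivity
    rw [hB, ← Real.rpow_mul this, one_div_mul_eq_div, neg_div, div_self hlam.ne', Real.rpow_neg_one]
  obtain ⟨y₀, hy₀⟩ := h.tailBound
  refine ⟨fun n => B n ^ (-lam), fun n => B n * B n ^ (-lam), hBt.eventually_ge_atTop 1, ?_, ?_, ?_⟩
  · filter_upwards [hBt.eventually_ge_atTop y₀, hBt.eventually_gt_atTop 0] with n h1 h2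
    exact hy₀ _ h1 h2
  · filter_upwards [hpow, hBt.eventually_gt_atTop 0, eventually_ge_atTop 1,
      tendsto_log_natCast_atTop.eventually_ge_atTop 1] with n h1 h2 hn hlog
    have hn' : (0 : ℝ) < n := by exact_mod_cast hn
    rw [h1, ← div_eq_mul_inv]
    gcongr
    exact le_mul_of_one_le_right hn'.le hlog
  · refine (tendsto_inv_atTop_zero.comp tendsto_log_natCast_atTop).congr' ?_
    filter_upwards [hpow, eventually_ge_atTop 1,
      tendsto_log_natCast_atTop.eventually_ge_atTop 1] with n h1 hn hlog
    have hn' : (0 : ℝ) < n := by exact_mod_cast hn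
    rw [h1, Function.comp_apply]
    field_simp

/-- Under exponential tails, `2 log n / λ` is a suitable truncation level. -/
lemma ConditionE.exists_truncation {F : Kernel ℝ ℝ} [IsMarkovKernel F] {S : Set ℝ} {lam : ℝ}
    (h : ConditionE F S lam) {B : ℕ → ℝ} (hB : B = fun n : ℕ => 2 / lam * Real.log n) :
    ∃ q β : ℕ → ℝ, (∀ᶠ n in atTop, 1 ≤ B n) ∧ (∀ᶠ n in atTop, TailBound F S (B n) (q n) (β n)) ∧
      (∀ᶠ n : ℕ in atTop, β n ≤ B n / n) ∧ Tendsto (fun n : ℕ => n * q n) atTop (𝓝 0) := by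
  have hlam : 0 < lam := h.1
  have hBt : Tendsto B atTop atTop := by
    rw [hB]
    exact tendsto_log_natCast_atTop.const_mul_atTop (by positivity)
  -- The factor `2` in `B` gives `n⁻²`, so that `n q = 1/n → 0` and `β = n⁻² / λ ≤ B / n`.
  have hexp : ∀ᶠ n : ℕ in atTop, Real.exp (-lam * B n) = ((n : ℝ) ^ 2)⁻¹ := by
    filter_upwards [eventually_ge_atTop 1] with n hn
    have hn' : (0 : ℝ) < n := by exact_mod_cast hn
    rw [hB, show -lam * (2 / lam * Real.log n) = -(Real.log n + Real.log n) by field_simp; ring,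
      Real.exp_neg, Real.exp_add, Real.exp_log hn', sq]
  obtain ⟨y₀, hy₀⟩ := h.tailBound
  refine ⟨fun n => Real.exp (-lam * B n), fun n => Real.exp (-lam * B n) / lam,
    hBt.eventually_ge_atTop 1, ?_, ?_, ?_⟩
  · filter_upwards [hBt.eventually_ge_atTop y₀] with n h1
    exact hy₀ _ h1
  · filter_upwards [hexp, eventually_ge_atTop 1,
      tendsto_log_natCast_atTop.eventually_ge_atTop 1] with n h1 hn hlog
    have hn' : (1 : ℝ) ≤ n := by exact_mod_cast hn
    rw [h1, hB]
    have h2 : ((n : ℝ) ^ 2)⁻¹ ≤ (n : ℝ)⁻¹ := by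
      gcongr
      nlinarith
    calc ((n : ℝ) ^ 2)⁻¹ / lam ≤ (n : ℝ)⁻¹ / lam := by gcongr
      _ = 1 / lam * 1 / n := by
        field_simp
      _ ≤ 2 / lam * Real.log n / n := by
        gcongr
        norm_num
  · refine (tendsto_inv_atTop_zero.comp (tendsto_natCast_atTop_atTop (R := ℝ))).congr' ?_
    filter_upwards [hexp, eventually_ge_atTop 1] with n h1 hn
    have hn' : (0 : ℝ) < n := by exact_mod_cast hn
    rw [h1, Function.comp_apply]
    field_simp

lemma sqrt_div_mul_eq_rpow {l n p : ℝ} (hl : 0 ≤ l) (hn : 0 ≤ n) (hp : 0 ≤ p) :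
    √(l / (n * p)) = l ^ (1 / 2 : ℝ) * n ^ (-1 / 2 : ℝ) * p ^ (-1 / 2 : ℝ) := by
  rw [Real.sqrt_eq_rpow, Real.div_rpow hl (by positivity), Real.mul_rpow hn hp,
    show (-1 / 2 : ℝ) = -(1 / 2) by norm_num, Real.rpow_neg hn, Real.rpow_neg hp, div_eq_mul_inv,
    mul_inv, mul_assoc]

/-- Powers of the logarithm are negligible with respect to powers. -/
lemma tendsto_rpow_mul_log_rpow {a : ℝ} (ha : a < 0) (b : ℝ) :
    Tendsto (fun n : ℕ => (n : ℝ) ^ a * Real.log n ^ b) atTop (𝓝 0) := by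
  have h := ((isLittleO_log_rpow_rpow_atTop b (neg_pos.2 ha)).tendsto_div_nhds_zero).comp
    tendsto_natCast_atTop_atTop
  refine h.congr fun n => ?_
  simp only [Function.comp_apply]
  rw [Real.rpow_neg (Nat.cast_nonneg n), div_inv_eq_mul, mul_comm]

/-! ### The four cases -/

theorem theorem3p2 {Ω : Type*} [MeasurableSpace Ω] (μ : Measure Ω) [IsProbabilityMeasure μ]
    (X Y : (n : ℕ) → Fin n → Ω → ℝ) (F : Kernel ℝ ℝ) [IsMarkovKernel F]
    (Mt : ℕ → Ω → ℝ → ℝ → ℝ)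
    (hMt : ∀ n ω, IsEstimator (fun i => X n i ω) (fun i => Y n i ω) (Mt n ω)) :
    -- (K) and (P)
    (∀ (K : ℕ) (p lam : ℝ), IsSamplingModel μ X Y F (levels K) →
      ConditionK μ X K p → ConditionP F (levels K) lam →
      ConditionA μ F Mt
        (fun n => 4 * p ^ (-1 / 2 : ℝ) * (n : ℝ) ^ (-1 / 2 + 1 / lam)
          * Real.log n ^ (1 / 2 + 1 / lam))
        (fun _ => levels K)) ∧
    -- (K) and (E)
    (∀ (K : ℕ) (p lam : ℝ), IsSamplingModel μ X Y F (levels K) →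
      ConditionK μ X K p → ConditionE F (levels K) lam →
      ConditionA μ F Mt
        (fun n => 8 * p ^ (-1 / 2 : ℝ) * lam⁻¹ * (n : ℝ) ^ (-1 / 2 : ℝ)
          * Real.log n ^ (3 / 2 : ℝ))
        (fun _ => levels K)) ∧
    -- (C1), (C2) and (P)
    (∀ (S I : Set ℝ) (p L lam : ℝ), I ⊆ S → IsSamplingModel μ X Y F S →
      ConditionC1 μ X I p → ConditionC2 F I L → ConditionP F S lam →
      ConditionA μ F Mt
        (fun n => (4 * p ^ (-1 / 2 : ℝ) + L) * (n : ℝ) ^ (-1 / 3 + 2 / (3 * lam))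
          * Real.log n ^ (1 / 3 + 2 / (3 * lam)))
        (fun n => interiorPart I
          ((n : ℝ) ^ (-1 / 3 + 2 / (3 * lam)) * Real.log n ^ (1 / 3 + 2 / (3 * lam))))) ∧
    -- (C1), (C2) and (E)
    (∀ (S I : Set ℝ) (p L lam : ℝ), I ⊆ S → IsSamplingModel μ X Y F S →
      ConditionC1 μ X I p → ConditionC2 F I L → ConditionE F S lam →
      ConditionA μ F Mt
        (fun n => (2 / lam) ^ (2 / 3 : ℝ) * (4 * p ^ (-1 / 2 : ℝ) + L) * (n : ℝ) ^ (-1 / 3 : ℝ)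
          * Real.log n)
        (fun n => interiorPart I
          ((2 / lam) ^ (2 / 3 : ℝ) * (n : ℝ) ^ (-1 / 3 : ℝ) * Real.log n))) := by
  have hlarge : ∀ᶠ n : ℕ in atTop, (0 : ℝ) < n ∧ 0 < Real.log n :=
    (tendsto_natCast_atTop_atTop.eventually_gt_atTop 0).and
      (tendsto_log_natCast_atTop.eventually_gt_atTop 0)
  refine ⟨fun K p lam hmodel hK hP => ?_, fun K p lam hmodel hK hE => ?_,
    fun S I p L lam hIS hmodel hC1 hC2 hP => ?_, fun S I p L lam hIS hmodel hC1 hC2 hE => ?_⟩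
  · have hp := hK.1
    obtain ⟨q, β, hB, hT, hβ, hq⟩ := hP.exists_truncation rfl
    refine conditionA_of_levels hMt hmodel hK (hB.mono fun n hn => one_pos.trans_le hn) hT hβ hq
      (fun n => by positivity) ?_
    filter_upwards [hlarge] with n ⟨hn, hl⟩
    rw [stochasticError, sqrt_div_mul_eq_rpow hl.le hn.le hp.le, Real.mul_rpow hn.le hl.le,
      Real.rpow_add hn, Real.rpow_add hl]
    ring
  · have hp := hK.1
    have hlam := hE.1
    obtain ⟨q, β, hB, hT, hβ, hq⟩ := hE.exists_truncation rfl
    refine conditionA_of_levels hMt hmodel hK (hB.mono fun n hn => one_pos.trans_le hn) hT hβ hq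
      (fun n => by positivity) ?_
    filter_upwards [hlarge] with n ⟨hn, hl⟩
    rw [stochasticError, sqrt_div_mul_eq_rpow hl.le hn.le hp.le,
      show (3 / 2 : ℝ) = 1 + 1 / 2 by norm_num, Real.rpow_add hl, Real.rpow_one]
    ring
  · have hp := hC1.1
    have hL := hC2.1
    have hlam : 0 < lam := by linarith [hP.1]
    -- Here `λ > 2` ensures that `δ n` tends to zero.
    have hexp : -1 / 3 + 2 / (3 * lam) < 0 := by
      have : 2 / (3 * lam) < 1 / 3 := by
        rw [div_lt_div_iff₀ (by positivity) (by norm_num)]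
        linarith [hP.1]
      linarith
    obtain ⟨q, β, hB, hT, hβ, hq⟩ := hP.exists_truncation rfl
    refine conditionA_of_density hMt hIS hmodel hC1 hC2 hB hT hβ hq (fun n => by positivity)
      (hlarge.mono fun n ⟨hn, hl⟩ => by positivity)
      ((tendsto_rpow_mul_log_rpow hexp _).eventually_le_const one_pos)
      (hlarge.mono fun n ⟨hn, hl⟩ => ?_) (Eventually.of_forall fun n => by ring)
    have h1 : (3 : ℝ) * (-1 / 3 + 2 / (3 * lam)) = -1 + 1 / lam * 2 := by
      field_simp
    have h2 : (3 : ℝ) * (1 / 3 + 2 / (3 * lam)) = 1 + 1 / lam * 2 := by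
      field_simp
    have hpow : ∀ z : ℝ, 0 < z → ∀ a : ℝ, (z ^ a) ^ 3 = z ^ (3 * a) := fun z hz a => by
      rw [mul_comm, Real.rpow_mul hz.le]
      norm_cast
    rw [mul_pow, hpow _ hn, hpow _ hl, h1, h2, ← Real.rpow_natCast (_ ^ (1 / lam)),
      ← Real.rpow_mul (by positivity), Real.mul_rpow hn.le hl.le, Real.rpow_add hn,
      Real.rpow_add hl, Real.rpow_neg_one, Real.rpow_one]
    push_cast
    ring
  · have hp := hC1.1
    have hL := hC2.1
    have hlam := hE.1
    obtain ⟨q, β, hB, hT, hβ, hq⟩ := hE.exists_truncation rfl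
    refine conditionA_of_density hMt hIS hmodel hC1 hC2 hB hT hβ hq (fun n => by positivity)
      (hlarge.mono fun n ⟨hn, hl⟩ => by positivity) ?_
      (hlarge.mono fun n ⟨hn, hl⟩ => ?_) (Eventually.of_forall fun n => by ring)
    · have h1 := (tendsto_rpow_mul_log_rpow (a := -1 / 3) (by norm_num) 1).const_mul
        ((2 / lam) ^ (2 / 3 : ℝ))
      rw [mul_zero] at h1
      refine (h1.eventually_le_const one_pos).mono fun n hn => ?_
      rwa [Real.rpow_one, ← mul_assoc] at hn
    · have h1 : ((2 / lam) ^ (2 / 3 : ℝ)) ^ 3 = (2 / lam) ^ 2 := by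
        rw [← Real.rpow_natCast, ← Real.rpow_mul (by positivity), ← Real.rpow_natCast]
        norm_num
      have h2 : ((n : ℝ) ^ (-1 / 3 : ℝ)) ^ 3 = (n : ℝ)⁻¹ := by
        rw [← Real.rpow_natCast, ← Real.rpow_mul hn.le, ← Real.rpow_neg_one]
        norm_num
      rw [mul_pow, mul_pow, h1, h2]
      ring
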